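/- **Functoriality of quantization.** Let $\mathbb{F}_q$ be a finite field with $q$ odd, let $\psi:\mathbb{F}_q\to\mathbb{C}^\times$ be a non-trivial additive character, let $\sigma$ be the quadratic character of $\mathbb{F}_q^\times$ and $G_1=\sum_{z\in\mathbb{F}_q}\psi(\tfrac12 z^2)$. Let $\mathsf{Symp}$ be the category of finite dimensional symplectic vector spaces over $\mathbb{F}_q$ with symplectic linear isomorphisms as morphisms, and $\mathsf{Vect}$ the category of finite dimensional complex vector spaces. For $(V,\omega)\in\mathsf{Symp}$ of dimension $2n$, let $H(V)=V\times\mathbb{F}_q$ be the Heisenberg group, with product $(v,z)(v',z')=(v+v',z+z'+\tfrac12\omega(v,v'))$. Let $OLag(V)$ be the set of oriented Lagrangians $L^\circ=(L,o_L)$, where $L\subset V$ is a Lagrangian subspace and $0\ne o_L\in\bigwedge^{top}L$. Let $\mathcal{H}_{L^\circ}$ be the space of functions $f:H(V)\to\mathbb{C}$ with $f((0,z)\cdot h)=\psi(z)f(h)$ for $z\in\mathbb{F}_q$ and $f((l,0)\cdot h)=f(h)$ for $l\in L$, on which $H(V)$ acts by right translation. A trivialization of the bundle $L^\circ\mapsto\mathcal{H}_{L^\circ}$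 is a system of $H(V)$-equivariant isomorphisms $T_{M^\circ,L^\circ}:\mathcal{H}_{L^\circ}\to\mathcal{H}_{M^\circ}$, for all $M^\circ,L^\circ\in OLag(V)$, with $T_{N^\circ,M^\circ}\circ T_{M^\circ,L^\circ}=T_{N^\circ,L^\circ}$. 1. For every $V$ there is exactly one trivialization (the canonical one) such that, whenever $L+M=V$, $$T_{M^\circ,L^\circ}[f](h)=\Big(\frac{G_1}{q}\Big)^{n}\sigma\Big((-1)^{\binom n2}\omega_\wedge(o_L,o_M)\Big)\sum_{m\in M}f\big((m,0)\cdot h\big),$$ where $\omega_\wedge$ is the bilinear pairing of top exterior powers induced by $\omega$, normalized by $\omega_\wedge(l_1\wedge\dots\wedge l_n,m_1\wedge\dots\wedge m_n)=(-1)^{\binom n2}\det(\omega(l_i,m_j))$. Let $\mathcal{H}(V)$ be the space of its horizontal sections, that is, of families $(v_{L^\circ}\in\mathcal{H}_{L^\circ})_{L^\circ\in OLag(V)}$ with $T_{M^\circ,L^\circ}(v_{L^\circ})=v_{M^\circ}$ for all $M^\circ,L^\circ$. 2. The rule $V\mapsto\mathcal{H}(V)$ defines a contravariant functor $\mathcal{H}:\mathsf{Symp}\to\mathsf{Vect}$.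 On a morphism $f:V\to W$ it is the pull-back $\mathcal{H}(f):\mathcal{H}(W)\to\mathcal{H}(V)$, $(\mathcal{H}(f)s)_{L^\circ}(v,z)=s_{f(L^\circ)}(f(v),z)$. 3. In particular, for every $V$, $\rho_V(g)=\mathcal{H}(g^{-1})$ is a linear representation of $Sp(V)$ on $\mathcal{H}(V)$, the canonical model of the Weil representation: with the fibrewise action $\pi$ of $H(V)$, the space $\mathcal{H}(V)$ is an irreducible representation of $H(V)$ with central character $\psi$, and $\rho_V(g)\,\pi(h)=\pi(g(h))\,\rho_V(g)$ for all $g\in Sp(V)$, $h\in H(V)$, where $g(v,z)=(gv,z)$. -/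

import Mathlib

open CategoryTheory

universe u v

noncomputable section

namespace SympQuant

/-- A finite dimensional symplectic vector space over the field `F`. -/
structure Symp (F : Type v) [Field F] : Type (max v (u + 1)) where
  carrier : Type u
  [addCommGroup : AddCommGroup carrier]
  [module : Module F carrier]
  [finiteDimensional : FiniteDimensional F carrier]
  form : LinearMap.BilinForm F carrier
  isAlt : form.IsAlt
  nondegenerate : form.Nondegenerate

attribute [instance] Symp.addCommGroup Symp.module Symp.finiteDimensional

instance (F : Type v) [Field F] : CoeSort (Symp.{u, v} F) (Type u) := ⟨Symp.carrier⟩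

/-- Linear isomorphisms of symplectic vector spaces. -/
def SympIso {F : Type v} [Field F] (V W : Symp.{u, v} F) : Type u :=
  {f : V ≃ₗ[F] W // ∀ x y : V, W.form (f x) (f y) = V.form x y}

/-- The groupoid of finite dimensional symplectic vector spaces. -/
instance (F : Type v) [Field F] : Category.{u} (Symp.{u, v} F) where
  Hom V W := SympIso V W
  id V := ⟨LinearEquiv.refl F V, fun _ _ => rfl⟩
  comp f g := ⟨f.1.trans g.1, fun x y => (g.2 (f.1 x) (f.1 y)).trans (f.2 x y)⟩

section

variable {F : Type v} [Field F]

/-- The underlying linear isomorphism of a morphism of symplectic spaces. -/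
def toLin {V W : Symp.{u, v} F} (f : V ⟶ W) : V ≃ₗ[F] W := f.1

theorem form_toLin {V W : Symp.{u, v} F} (f : V ⟶ W) (x y : V) :
    W.form (toLin f x) (toLin f y) = V.form x y := f.2 x y

/-- The symplectic group `Sp(V)`. -/
def Sp (V : Symp.{u, v} F) : Subgroup (V ≃ₗ[F] V) where
  carrier := {g | ∀ x y : V, V.form (g x) (g y) = V.form x y}
  one_mem' _ _ := rfl
  mul_mem' {a b} ha hb x y := (ha (b x) (b y)).trans (hb x y)
  inv_mem' {a} ha x y := by
    have h := ha (a⁻¹ x) (a⁻¹ y)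
    rw [← LinearEquiv.mul_apply, ← LinearEquiv.mul_apply, mul_inv_cancel] at h
    exact h.symm

/-- An element of `Sp(V)` as a morphism `V ⟶ V`. -/
def Sp.hom {V : Symp.{u, v} F} (g : Sp V) : V ⟶ V := ⟨g.1, g.2⟩

/-- The number `n` with `dim V = 2n`. -/
def halfDim (V : Symp.{u, v} F) : ℕ := Module.finrank F V / 2

/-! ### The Heisenberg group -/

/-- The Heisenberg group `H(V)`, with underlying set `V × F`. -/
@[ext]
structure Heis (V : Symp.{u, v} F) : Type (max u v) where
  vec : V
  cen : F

namespace Heis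

variable {V : Symp.{u, v} F}

/-- `(v, z) (v', z') = (v + v', z + z' + ½ ω(v, v'))`. -/
instance : Mul (Heis V) :=
  ⟨fun a b => ⟨a.vec + b.vec, a.cen + b.cen + (2 : F)⁻¹ * V.form a.vec b.vec⟩⟩

instance : One (Heis V) := ⟨⟨0, 0⟩⟩

instance : Inv (Heis V) := ⟨fun a => ⟨-a.vec, -a.cen⟩⟩

@[simp] theorem mul_vec (a b : Heis V) : (a * b).vec = a.vec + b.vec := rfl
@[simp] theorem mul_cen (a b : Heis V) :
    (a * b).cen = a.cen + b.cen + (2 : F)⁻¹ * V.form a.vec b.vec := rfl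
@[simp] theorem one_vec : (1 : Heis V).vec = 0 := rfl
@[simp] theorem one_cen : (1 : Heis V).cen = 0 := rfl
@[simp] theorem inv_vec (a : Heis V) : (a⁻¹).vec = -a.vec := rfl
@[simp] theorem inv_cen (a : Heis V) : (a⁻¹).cen = -a.cen := rfl

instance : Group (Heis V) :=
  Group.ofLeftAxioms
    (fun a b c => by
      ext
      · simp [add_assoc]
      · simp; ring)
    (fun a => by ext <;> simp)
    (fun a => by ext <;> simp [V.isAlt a.vec])

/-- The central element `(0, z)`. -/
def ofCenter (z : F) : Heis V := ⟨0, z⟩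

/-- The element `(v, 0)`. -/
def ofVec (v : V) : Heis V := ⟨v, 0⟩

/-- The isomorphism `(v, z) ↦ (f v, z)` of Heisenberg groups induced by a symplectic
isomorphism `f`. -/
def map {V W : Symp.{u, v} F} (f : V ⟶ W) (h : Heis V) : Heis W := ⟨toLin f h.vec, h.cen⟩

instance [Finite F] : Finite (Heis V) := by
  have : Finite V := Module.finite_of_finite F
  exact Finite.of_injective (fun h : Heis V => (h.vec, h.cen)) fun a b h => by
    ext
    · exact congrArg Prod.fst h
    · exact congrArg Prod.snd h

end Heis

/-! ### Oriented Lagrangians -/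

/-- `L` is Lagrangian: it equals its own orthogonal complement. -/
def IsLagrangian (V : Symp.{u, v} F) (L : Submodule F V) : Prop := V.form.orthogonal L = L

theorem IsLagrangian.finrank_eq {V : Symp.{u, v} F} {L : Submodule F V}
    (hL : IsLagrangian V L) : Module.finrank F L = halfDim V := by
  have h := LinearMap.BilinForm.finrank_orthogonal V.nondegenerate L
  have h' := Submodule.finrank_le L
  rw [hL] at h
  unfold halfDim
  omega

theorem finrank_eq_of_hom {V W : Symp.{u, v} F} (f : V ⟶ W) : halfDim V = halfDim W := by
  unfold halfDim
  rw [(toLin f).finrank_eq]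

/-- An oriented Lagrangian `(L, o_L)`: a Lagrangian subspace `L` with a non-zero vector `o_L` of
the line `⋀^top L`. As `dim L = n`, the line `⋀^top L` is `⋀^n L`; it is regarded as a subspace of
`⋀^n V` through the (injective) map induced by the inclusion of `L` into `V`. -/
@[ext]
structure OLag (V : Symp.{u, v} F) : Type (max u v) where
  lag : Submodule F V
  isLagrangian : IsLagrangian V lag
  orient : ⋀[F]^(halfDim V) V
  orient_mem : orient ∈ LinearMap.range (exteriorPower.map (halfDim V) lag.subtype)
  orient_ne_zero : orient ≠ 0

instance [Finite F] (V : Symp.{u, v} F) : Finite (OLag V) := by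
  have : Finite V := Module.finite_of_finite F
  have : Finite (⋀[F]^(halfDim V) V) := Module.finite_of_finite F
  exact Finite.of_injective (fun L : OLag V => (L.lag, L.orient)) fun a b h =>
    OLag.ext (congrArg Prod.fst h) (congrArg Prod.snd h)

instance [Finite F] {V : Symp.{u, v} F} (L : OLag V) : Fintype L.lag :=
  have : Finite V := Module.finite_of_finite F
  Fintype.ofFinite _

theorem OLag.form_eq_zero {V : Symp.{u, v} F} (L : OLag V) {x y : V} (hx : x ∈ L.lag)
    (hy : y ∈ L.lag) : V.form x y = 0 := by
  have h : y ∈ V.form.orthogonal L.lag := by rw [L.isLagrangian]; exact hy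
  exact h x hx

/-- The map `⋀^n V → ⋀^n W` induced by a symplectic isomorphism. -/
def mapTop {V W : Symp.{u, v} F} (f : V ⟶ W) (o : ⋀[F]^(halfDim V) V) : ⋀[F]^(halfDim W) W :=
  ⟨(exteriorPower.map (halfDim V) (toLin f).toLinearMap o : ExteriorAlgebra F W), by
    rw [← finrank_eq_of_hom f]; exact Subtype.property _⟩

/-- The map `(L, o_L) ↦ (f L, f o_L)` induced by a symplectic isomorphism `f`. -/
def OLag.map {V W : Symp.{u, v} F} (f : V ⟶ W) (L : OLag V) : OLag W where
  lag := L.lag.map (toLin f).toLinearMap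
  isLagrangian := by
    ext y
    obtain ⟨x, rfl⟩ := (toLin f).surjective y
    have h : x ∈ V.form.orthogonal L.lag ↔ x ∈ L.lag := by rw [L.isLagrangian]
    have h2 : toLin f x ∈ L.lag.map (toLin f).toLinearMap ↔ x ∈ L.lag := by
      simp
    rw [h2, ← h]
    constructor
    · intro hx m hm
      have := hx (toLin f m) ⟨m, hm, rfl⟩
      rwa [form_toLin] at this
    · rintro hx _ ⟨m, hm, rfl⟩
      exact (form_toLin f m x).trans (hx m hm)
  orient := mapTop f L.orient
  orient_mem := by
    obtain ⟨o, ho⟩ := L.orient_mem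
    have key : ∀ (k : ℕ) (hk : halfDim V = k),
        ∃ o' : ⋀[F]^k (L.lag.map (toLin f).toLinearMap),
          ((exteriorPower.map k (L.lag.map (toLin f).toLinearMap).subtype o' : ⋀[F]^k W) :
            ExteriorAlgebra F W) =
          (exteriorPower.map (halfDim V) (toLin f).toLinearMap L.orient : ExteriorAlgebra F W) := by
      rintro k rfl
      refine ⟨exteriorPower.map _ ((toLin f).toLinearMap.submoduleMap L.lag) o, ?_⟩
      rw [← ho, ← LinearMap.comp_apply, ← LinearMap.comp_apply, ← exteriorPower.map_comp,
        ← exteriorPower.map_comp]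
      rfl
    obtain ⟨o', ho'⟩ := key _ (finrank_eq_of_hom f)
    exact ⟨o', Subtype.ext ho'⟩
  orient_ne_zero h := by
    have h1 : exteriorPower.map (halfDim V) (toLin f).toLinearMap L.orient = 0 :=
      by
      have h0 : ((mapTop f L.orient : ⋀[F]^(halfDim W) W) : ExteriorAlgebra F W) = 0 := by
        rw [h]; rfl
      exact Subtype.ext h0
    have h2 := exteriorPower.map_injective_field (n := halfDim V)
      (f := (toLin f).toLinearMap) (toLin f).injective
    exact L.orient_ne_zero (h2 (h1.trans (map_zero _).symm))

/-- The pairing `ω_∧` on `⋀^n V` induced by the symplectic form, normalized by contracting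
neighbouring factors successively:
`ω_∧ (l₁ ∧ … ∧ lₙ, m₁ ∧ … ∧ mₙ) = (-1)^(n choose 2) det (ω(lᵢ, mⱼ))`. -/
def wedgeForm (V : Symp.{u, v} F) (x y : ⋀[F]^(halfDim V) V) : F :=
  (-1) ^ (halfDim V).choose 2 *
    exteriorPower.pairingDual F V (halfDim V) (exteriorPower.map (halfDim V) V.form x) y

/-! ### The models of the Heisenberg representation -/

/-- The space `ℋ_L` of functions `f` on `H(V)` with `f (z h) = ψ(z) f(h)` for `z` in the centre and
`f (l h) = f(h)` for `l ∈ L`. -/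
def Fibre (ψ : AddChar F ℂ) {V : Symp.{u, v} F} (L : OLag V) : Submodule ℂ (Heis V → ℂ) where
  carrier := {f | (∀ (z : F) (h : Heis V), f (Heis.ofCenter z * h) = ψ z * f h) ∧
    ∀ l ∈ L.lag, ∀ h : Heis V, f (Heis.ofVec l * h) = f h}
  zero_mem' := by simp
  add_mem' {f g} hf hg := by
    refine ⟨fun z h => ?_, fun l hl h => ?_⟩
    · simp only [Pi.add_apply, hf.1, hg.1, mul_add]
    · simp only [Pi.add_apply, hf.2 l hl, hg.2 l hl]
  smul_mem' c f hf := by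
    refine ⟨fun z h => ?_, fun l hl h => ?_⟩
    · simp only [Pi.smul_apply, hf.1, smul_eq_mul, mul_left_comm]
    · simp only [Pi.smul_apply, hf.2 l hl]

/-- The Heisenberg action on `ℋ_L` by right translation. -/
def fibreRep (ψ : AddChar F ℂ) {V : Symp.{u, v} F} (L : OLag V) :
    Representation ℂ (Heis V) (Fibre ψ L) where
  toFun h :=
    { toFun := fun f => ⟨fun h' => f.1 (h' * h),
        fun z h' => by simpa only [mul_assoc] using f.2.1 z (h' * h),
        fun l hl h' => by simpa only [mul_assoc] using f.2.2 l hl (h' * h)⟩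
      map_add' := fun _ _ => rfl
      map_smul' := fun _ _ => rfl }
  map_one' := by
    ext f h
    simp
  map_mul' a b := by
    ext f h
    simp [mul_assoc]

/-- The averaging morphism `F_{M,L} : ℋ_L → ℋ_M`, `F_{M,L}[f](h) = ∑_{m ∈ M} f(m h)`. -/
def averaging [Finite F] (ψ : AddChar F ℂ) {V : Symp.{u, v} F} (M L : OLag V) :
    Fibre ψ L →ₗ[ℂ] Fibre ψ M where
  toFun f := ⟨fun h => ∑ m : M.lag, f.1 (Heis.ofVec m.1 * h), by
    constructor
    · intro z h
      rw [Finset.mul_sum]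
      refine Finset.sum_congr rfl fun m _ => ?_
      rw [← f.2.1]
      refine congrArg f.1 (Heis.ext ?_ ?_)
      · simp [Heis.ofVec, Heis.ofCenter, add_comm]
      · simp [Heis.ofVec, Heis.ofCenter]; ring
    · intro l hl h
      refine Fintype.sum_equiv (Equiv.addRight ⟨l, hl⟩) _ _ fun m => ?_
      refine congrArg f.1 (Heis.ext ?_ ?_)
      · simp [Heis.ofVec, add_assoc]
      · simp [Heis.ofVec, M.form_eq_zero m.2 hl]; ring⟩
  map_add' f g := by
    ext h
    exact Finset.sum_add_distrib
  map_smul' c f := by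
    ext h
    exact (Finset.mul_sum _ _ _).symm

/-- The one dimensional Gauss sum `G₁ = ∑_z ψ(z² / 2)`. -/
def gauss [Fintype F] (ψ : AddChar F ℂ) : ℂ := ∑ z : F, ψ ((2 : F)⁻¹ * z ^ 2)

/-- The normalization constant
`A_{M,L} = (G₁ / q)^n σ((-1)^(n choose 2) ω_∧(o_L, o_M))`, where `σ` is the quadratic character. -/
def normConst [Fintype F] [DecidableEq F] (ψ : AddChar F ℂ) {V : Symp.{u, v} F}
    (M L : OLag V) : ℂ :=
  (gauss ψ / Fintype.card F) ^ halfDim V *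
    ((quadraticChar F ((-1) ^ (halfDim V).choose 2 * wedgeForm V L.orient M.orient) : ℤ) : ℂ)

/-! ### Trivializations and horizontal sections -/

/-- A trivialization of the bundle `L ↦ ℋ_L` over the set of oriented Lagrangians: a multiplicative
system of intertwining isomorphisms `T_{M,L} : ℋ_L → ℋ_M`. -/
@[ext]
structure Trivialization (ψ : AddChar F ℂ) (V : Symp.{u, v} F) where
  T : ∀ M L : OLag V, Fibre ψ L ≃ₗ[ℂ] Fibre ψ M
  intertwines : ∀ (M L : OLag V) (h : Heis V) (f : Fibre ψ L),
    T M L (fibreRep ψ L h f) = fibreRep ψ M h (T M L f)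
  multiplicative : ∀ (N M L : OLag V) (f : Fibre ψ L), T N M (T M L f) = T N L f

namespace Trivialization

variable {ψ : AddChar F ℂ} {V : Symp.{u, v} F}

/-- The trivialization is given by `T_{M,L} = A_{M,L} F_{M,L}` for all pairs of oriented Lagrangians
in general position (`L + M = V`). -/
def ExtendsAnsatz [Fintype F] [DecidableEq F] (T : Trivialization ψ V) : Prop :=
  ∀ M L : OLag V, L.lag ⊔ M.lag = ⊤ →
    (T.T M L : Fibre ψ L →ₗ[ℂ] Fibre ψ M) = normConst ψ M L • averaging ψ M L

/-- The space of horizontal sections: the families `(v_L ∈ ℋ_L)` with `T_{M,L}(v_L) = v_M`. -/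
def horizontal (T : Trivialization ψ V) : Submodule ℂ (∀ L : OLag V, Fibre ψ L) where
  carrier := {s | ∀ M L : OLag V, T.T M L (s L) = s M}
  zero_mem' M L := map_zero (T.T M L)
  add_mem' {a b} ha hb M L := by
    rw [Pi.add_apply, map_add, ha, hb, Pi.add_apply]
  smul_mem' c a ha M L := by
    rw [Pi.smul_apply, map_smul, ha, Pi.smul_apply]

instance [Finite F] (T : Trivialization ψ V) : Module.Finite ℂ T.horizontal := inferInstance

/-- The action of `H(V)` on horizontal sections, induced by the fibrewise action. -/
def heisRep (T : Trivialization ψ V) : Representation ℂ (Heis V) T.horizontal where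
  toFun h :=
    { toFun := fun s => ⟨fun L => fibreRep ψ L h (s.1 L), fun M L => by
        rw [T.intertwines, s.2 M L]⟩
      map_add' := fun a b => by
        ext L : 2
        exact map_add (fibreRep ψ L h) _ _
      map_smul' := fun c a => by
        ext L : 2
        exact map_smul (fibreRep ψ L h) _ _ }
  map_one' := by
    ext s L : 3
    simp
  map_mul' a b := by
    ext s L : 3
    simp

end Trivialization

/-- Given a choice of trivializations and a contravariant functor to finite dimensional vector
spaces whose value at every `V` is the space of horizontal sections, the linear map that the functor
attaches to `f : V ⟶ W`, as a map between spaces of horizontal sections. -/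
def onSections [Finite F] {ψ : AddChar F ℂ} {T : ∀ V : Symp.{u, v} F, Trivialization ψ V}
    {Q : (Symp.{u, v} F)ᵒᵖ ⥤ FGModuleCat.{max u v} ℂ}
    (hQ : ∀ V, Q.obj (Opposite.op V) = FGModuleCat.of ℂ (T V).horizontal)
    {V W : Symp.{u, v} F} (f : V ⟶ W) : (T W).horizontal →ₗ[ℂ] (T V).horizontal :=
  (eqToHom (hQ W).symm ≫ Q.map f.op ≫ eqToHom (hQ V)).hom.hom

end

end SympQuant

end

noncomputable section

namespace SympQuant

/-! ### Three proper subspaces do not cover a vector space -/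

/-! For transversal Lagrangians the operator `T_{M,L}` is prescribed. For the other pairs it must be
`T_{M,S} T_{S,L}` with `S` transversal to both, so uniqueness is immediate and the work lies in
independence of `S`. Such `S` exist, even for three Lagrangians at once, because three proper
subspaces do not cover a vector space when `2 ≠ 0` (`exists_isLagrangian_transversal`).

By Schur's lemma (`Fibre.end_eq_smul`) two intertwining isomorphisms agree as soon as one non-zero
matrix entry agrees. The entry used is the value at `1` of the image of the delta function on `L`.
For `F_{N,S} F_{S,L}` it is the Gauss sum of the quadratic form `ω(x, p x)` on `N`, where `p`
projects to `S` along `L`. The radical of this form is `L ∩ N`; on a complement with Gram matrix `D`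
the sum yields `σ(det D)`. The identity `det_gram_mul_det_gram` expresses `det D`, up to squares,
through the determinants in the normalization constants and a factor free of `S`, and `o_S` enters
twice, so every trace of `S` disappears (`exists_entry`). If `L + N = V`, then `G₁² = σ(-1) q`
reduces the entry to `A_{N,L}`, so the extension restricts to the given formula. Multiplicativity
follows by routing all three operators through a common `S`.

Functoriality is a consequence of uniqueness: the pull-back of the canonical trivialization along a
symplectic isomorphism satisfies the same formula, hence is canonical (`canonical_pull`).
Irreducibility holds because averaging over `L` sends any vector to a multiple of the delta
function, whose translates span. -/

theorem exists_notMem_two {K E : Type*} [Field K] [AddCommGroup E] [Module K E]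
    {p₁ p₂ : Submodule K E} (h₁ : p₁ ≠ ⊤) (h₂ : p₂ ≠ ⊤) : ∃ x, x ∉ p₁ ∧ x ∉ p₂ := by
  obtain ⟨x, hx⟩ := SetLike.exists_not_mem_of_ne_top p₁ h₁
  obtain ⟨y, hy⟩ := SetLike.exists_not_mem_of_ne_top p₂ h₂
  by_cases hx₂ : x ∈ p₂
  · by_cases hy₁ : y ∈ p₁
    · exact ⟨x + y, fun h => hx ((p₁.add_mem_iff_left hy₁).1 h),
        fun h => hy ((p₂.add_mem_iff_right hx₂).1 h)⟩
    · exact ⟨y, hy₁, hy⟩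
  · exact ⟨x, hx, hx₂⟩

/-- Pigeonhole: if `x` avoids `p₁`, `p₂` but lies in `p₃`, and `y ∉ p₃`, then `y`, `y + x`, `y - x`
all avoid `p₃`. Their differences are `±x` and `2x`, so each of `p₁`, `p₂` contains at most one of
them. Over the field with two elements a plane is a union of three lines. -/
theorem exists_notMem_three {K E : Type*} [Field K] [AddCommGroup E] [Module K E]
    (hK : (2 : K) ≠ 0) {p₁ p₂ p₃ : Submodule K E} (h₁ : p₁ ≠ ⊤) (h₂ : p₂ ≠ ⊤) (h₃ : p₃ ≠ ⊤) :
    ∃ x, x ∉ p₁ ∧ x ∉ p₂ ∧ x ∉ p₃ := by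
  obtain ⟨x, hx₁, hx₂⟩ := exists_notMem_two h₁ h₂
  by_cases hx₃ : x ∈ p₃
  swap
  · exact ⟨x, hx₁, hx₂, hx₃⟩
  obtain ⟨y, hy⟩ := SetLike.exists_not_mem_of_ne_top p₃ h₃
  have hp : y + x ∉ p₃ := fun h => hy ((p₃.add_mem_iff_left hx₃).1 h)
  have hm : y - x ∉ p₃ := fun h => hy ((p₃.sub_mem_iff_left hx₃).1 h)
  have key : ∀ p : Submodule K E, x ∉ p →
      ¬(y ∈ p ∧ y + x ∈ p) ∧ ¬(y ∈ p ∧ y - x ∈ p) ∧ ¬(y + x ∈ p ∧ y - x ∈ p) := by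
    refine fun p hx => ⟨fun h => hx ?_, fun h => hx ?_, fun h => hx ?_⟩
    · simpa using p.sub_mem h.2 h.1
    · simpa using p.sub_mem h.1 h.2
    · have := p.sub_mem h.1 h.2
      rw [show y + x - (y - x) = (2 : K) • x by rw [two_smul]; abel] at this
      exact (p.smul_mem_iff hK).1 this
  by_contra hcon
  have k₁ := key p₁ hx₁
  have k₂ := key p₂ hx₂
  have c : ∀ z, z ∉ p₃ → z ∉ p₁ → z ∉ p₂ → False := fun z h₃ h₁ h₂ => hcon ⟨z, h₁, h₂, h₃⟩
  have c₀ := c y hy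
  have c₁ := c (y + x) hp
  have c₂ := c (y - x) hm
  by_cases a₀ : y ∈ p₁ <;> by_cases a₁ : y + x ∈ p₁ <;> by_cases a₂ : y - x ∈ p₁ <;>
    simp_all

/-! ### Isotropic and Lagrangian subspaces -/

section

variable {F : Type v} [Field F] {V : Symp.{u, v} F}

theorem form_swap (x y : V) : V.form x y = -V.form y x := by
  rw [← V.isAlt.neg_eq]

theorem isRefl (V : Symp.{u, v} F) : V.form.IsRefl := V.isAlt.isRefl

theorem orthogonal_sup (A B : Submodule F V) :
    V.form.orthogonal (A ⊔ B) = V.form.orthogonal A ⊓ V.form.orthogonal B := by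
  refine le_antisymm (le_inf (LinearMap.BilinForm.orthogonal_le le_sup_left)
    (LinearMap.BilinForm.orthogonal_le le_sup_right)) ?_
  rintro x ⟨ha, hb⟩ y hy
  obtain ⟨a, ha', b, hb', rfl⟩ := Submodule.mem_sup.1 hy
  have h1 := ha a ha'
  have h2 := hb b hb'
  change V.form (a + b) x = 0
  rw [map_add, LinearMap.add_apply, show V.form a x = 0 from h1, show V.form b x = 0 from h2,
    add_zero]

theorem orthogonal_orthogonal (A : Submodule F V) :
    V.form.orthogonal (V.form.orthogonal A) = A :=
  LinearMap.BilinForm.orthogonal_orthogonal V.nondegenerate (isRefl V) A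

theorem IsLagrangian.sup_eq_top_iff {L M : Submodule F V} (hL : IsLagrangian V L)
    (hM : IsLagrangian V M) : L ⊔ M = ⊤ ↔ L ⊓ M = ⊥ := by
  have h := orthogonal_sup L M
  rw [hL, hM] at h
  rw [← h]
  constructor
  · rintro h
    rw [h]
    exact LinearMap.BilinForm.orthogonal_top_eq_bot V.nondegenerate
  · intro h'
    rw [← orthogonal_orthogonal (L ⊔ M), h', LinearMap.BilinForm.orthogonal_bot]

theorem IsLagrangian.isCompl {L M : Submodule F V} (hL : IsLagrangian V L)
    (hM : IsLagrangian V M) (h : L ⊔ M = ⊤) : IsCompl L M :=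
  ⟨disjoint_iff.2 ((hL.sup_eq_top_iff hM).1 h), codisjoint_iff.2 h⟩

/-- A proper isotropic subspace that meets `L` trivially: its orthogonal complement is not contained
in its sum with `L`. -/
theorem orthogonal_not_le_sup {L S : Submodule F V} (hL : IsLagrangian V L)
    (hS : S ≤ V.form.orthogonal S) (hSL : S ⊓ L = ⊥) (hne : S ≠ V.form.orthogonal S) :
    ¬V.form.orthogonal S ≤ S ⊔ L := by
  intro h
  apply hne
  -- Taking orthogonal complements of the assumed inclusion reverses it.
  have h1 : V.form.orthogonal S ⊓ L ≤ S := by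
    have := LinearMap.BilinForm.orthogonal_le (B := V.form) h
    rwa [orthogonal_orthogonal, orthogonal_sup, hL] at this
  have h2 : V.form.orthogonal S ⊓ L = ⊥ := by
    rw [eq_bot_iff, ← hSL]
    exact le_inf h1 inf_le_right
  refine le_antisymm hS fun x hx => ?_
  obtain ⟨s, hs, l, hl, rfl⟩ := Submodule.mem_sup.1 (h hx)
  have hl' : l ∈ V.form.orthogonal S := by
    have := Submodule.sub_mem _ hx (hS hs)
    simpa using this
  have : l ∈ V.form.orthogonal S ⊓ L := ⟨hl', hl⟩
  rw [h2, Submodule.mem_bot] at this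
  simpa [this] using hs

/-- Adding to an isotropic subspace a vector orthogonal to it yields an isotropic subspace. -/
theorem sup_span_le_orthogonal {S : Submodule F V} (hS : S ≤ V.form.orthogonal S) {x : V}
    (hx : x ∈ V.form.orthogonal S) : S ⊔ F ∙ x ≤ V.form.orthogonal (S ⊔ F ∙ x) := by
  rw [orthogonal_sup]
  have hxx : F ∙ x ≤ V.form.orthogonal S := by
    rw [Submodule.span_singleton_le_iff_mem]; exact hx
  have hxS : S ≤ V.form.orthogonal (F ∙ x) := by
    have := LinearMap.BilinForm.orthogonal_le (B := V.form) hxx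
    rwa [orthogonal_orthogonal] at this
  refine sup_le (le_inf hS hxS) (le_inf hxx ?_)
  rw [Submodule.span_singleton_le_iff_mem]
  intro y hy
  obtain ⟨c, rfl⟩ := Submodule.mem_span_singleton.1 hy
  simp [V.isAlt x]

theorem exists_maximal_submodule (P : Submodule F V → Prop) (h : P ⊥) : ∃ S, Maximal P S := by
  obtain ⟨S, hS, hmax⟩ := WellFounded.has_min
    (wellFounded_gt (α := Submodule F V)) {S | P S} ⟨⊥, h⟩
  refine ⟨S, hS, fun T hT hST => ?_⟩
  rcases hST.eq_or_lt with h | h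
  · exact h.ge
  · exact absurd h (hmax T hT)

theorem exists_isLagrangian (V : Symp.{u, v} F) : ∃ L, IsLagrangian V L := by
  obtain ⟨S, hS, hmax⟩ :=
    exists_maximal_submodule (fun S : Submodule F V => S ≤ V.form.orthogonal S) bot_le
  refine ⟨S, le_antisymm (fun x hx => ?_) hS⟩
  exact hmax (sup_span_le_orthogonal hS hx) le_sup_left
    (Submodule.mem_sup_right (Submodule.mem_span_singleton_self x))

/-- Take `S` maximal among the isotropic subspaces meeting every `Lᵢ` trivially. Were `S` not
Lagrangian, each `S + Lᵢ` would cut out a proper subspace of the orthogonal complement of `S`, and a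
vector outside all three would enlarge `S`. -/
theorem exists_isLagrangian_transversal (hF : (2 : F) ≠ 0) {L₁ L₂ L₃ : Submodule F V}
    (h₁ : IsLagrangian V L₁) (h₂ : IsLagrangian V L₂) (h₃ : IsLagrangian V L₃) :
    ∃ S, IsLagrangian V S ∧ S ⊔ L₁ = ⊤ ∧ S ⊔ L₂ = ⊤ ∧ S ⊔ L₃ = ⊤ := by
  let P : Submodule F V → Prop := fun S =>
    S ≤ V.form.orthogonal S ∧ S ⊓ L₁ = ⊥ ∧ S ⊓ L₂ = ⊥ ∧ S ⊓ L₃ = ⊥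
  obtain ⟨S, hS⟩ := exists_maximal_submodule P (by simp [P])
  obtain ⟨⟨hiso, i₁, i₂, i₃⟩, hmax⟩ := hS
  have hLag : IsLagrangian V S := by
    by_contra hne
    have hne' : S ≠ V.form.orthogonal S := fun h => hne h.symm
    have aux : ∀ L, IsLagrangian V L → S ⊓ L = ⊥ →
        (S ⊔ L).comap (V.form.orthogonal S).subtype ≠ ⊤ := fun L hL hSL h =>
      orthogonal_not_le_sup hL hiso hSL hne' (Submodule.comap_subtype_eq_top.1 h)
    obtain ⟨⟨x, hx⟩, x₁, x₂, x₃⟩ :=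
      exists_notMem_three hF (aux _ h₁ i₁) (aux _ h₂ i₂) (aux _ h₃ i₃)
    simp only [Submodule.mem_comap, Submodule.subtype_apply] at x₁ x₂ x₃
    have hxS : x ∉ S := fun h => x₁ (Submodule.mem_sup_left h)
    have inter : ∀ L : Submodule F V, S ⊓ L = ⊥ → x ∉ S ⊔ L → (S ⊔ F ∙ x) ⊓ L = ⊥ := by
      intro L hSL hxL
      rw [eq_bot_iff]
      rintro y ⟨hy, hyL⟩
      obtain ⟨s, hs, z, hz, rfl⟩ := Submodule.mem_sup.1 hy
      obtain ⟨c, rfl⟩ := Submodule.mem_span_singleton.1 hz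
      by_cases hc : c = 0
      · subst hc
        rw [← hSL]
        simp only [zero_smul, add_zero] at hyL ⊢
        exact ⟨hs, hyL⟩
      · refine absurd ?_ hxL
        rw [← (S ⊔ L).smul_mem_iff hc]
        have := (S ⊔ L).sub_mem (Submodule.mem_sup_right hyL) (Submodule.mem_sup_left (T := L) hs)
        simpa using this
    have hP : P (S ⊔ F ∙ x) :=
      ⟨sup_span_le_orthogonal hiso hx, inter _ i₁ x₁, inter _ i₂ x₂, inter _ i₃ x₃⟩
    exact hxS (hmax hP le_sup_left (Submodule.mem_sup_right (Submodule.mem_span_singleton_self x)))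
  exact ⟨S, hLag, (hLag.sup_eq_top_iff h₁).2 i₁, (hLag.sup_eq_top_iff h₂).2 i₂,
    (hLag.sup_eq_top_iff h₃).2 i₃⟩

/-! ### Orientations and bases -/

theorem IsLagrangian.ιMulti_basis_ne_zero {L : Submodule F V}
    (b : Module.Basis (Fin (halfDim V)) F L) :
    exteriorPower.ιMulti F (halfDim V) (fun i => (b i : V)) ≠ 0 := by
  have h0 : exteriorPower.ιMulti F (halfDim V) b ≠ 0 := by
    intro h
    have hd := exteriorPower.alternatingMapLinearEquiv_apply_ιMulti b.det b
    rw [h, map_zero, b.det_self] at hd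
    exact zero_ne_one hd
  have h1 := exteriorPower.map_injective_field (n := halfDim V) (f := L.subtype)
    (Subtype.val_injective)
  have h2 := exteriorPower.map_apply_ιMulti L.subtype b
  intro h
  refine h0 (h1 ?_)
  rw [h2, map_zero]
  exact h

theorem OLag.exists_of_isLagrangian {L : Submodule F V} (hL : IsLagrangian V L) :
    ∃ S : OLag V, S.lag = L := by
  let b := Module.finBasisOfFinrankEq F L hL.finrank_eq
  exact ⟨⟨L, hL, exteriorPower.ιMulti F (halfDim V) (fun i => (b i : V)),
    ⟨exteriorPower.ιMulti F (halfDim V) b, exteriorPower.map_apply_ιMulti L.subtype b⟩,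
    IsLagrangian.ιMulti_basis_ne_zero b⟩, rfl⟩

instance (V : Symp.{u, v} F) : Nonempty (OLag V) := by
  obtain ⟨L, hL⟩ := exists_isLagrangian V
  exact ⟨(OLag.exists_of_isLagrangian hL).choose⟩

theorem OLag.exists_transversal (hF : (2 : F) ≠ 0) (L₁ L₂ L₃ : OLag V) :
    ∃ S : OLag V, S.lag ⊔ L₁.lag = ⊤ ∧ S.lag ⊔ L₂.lag = ⊤ ∧ S.lag ⊔ L₃.lag = ⊤ := by
  obtain ⟨S, hS, h⟩ :=
    exists_isLagrangian_transversal hF L₁.isLagrangian L₂.isLagrangian L₃.isLagrangian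
  obtain ⟨S, rfl⟩ := OLag.exists_of_isLagrangian hS
  exact ⟨S, h⟩

theorem OLag.exists_middle (hF : (2 : F) ≠ 0) (L M : OLag V) :
    ∃ S : OLag V, L.lag ⊔ S.lag = ⊤ ∧ S.lag ⊔ M.lag = ⊤ := by
  obtain ⟨S, h₁, h₂, -⟩ := OLag.exists_transversal hF L M M
  exact ⟨S, by rwa [sup_comm], h₂⟩

theorem OLag.orient_eq_smul (L : OLag V) (b : Module.Basis (Fin (halfDim V)) F L.lag) :
    ∃ c : F, c ≠ 0 ∧ L.orient = c • exteriorPower.ιMulti F (halfDim V) (fun i => (b i : V)) := by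
  obtain ⟨o, ho⟩ := L.orient_mem
  have h1 : Module.finrank F (⋀[F]^(halfDim V) L.lag) = 1 := by
    rw [exteriorPower.finrank_eq, L.isLagrangian.finrank_eq, Nat.choose_self]
  have h0 : exteriorPower.ιMulti F (halfDim V) b ≠ 0 := by
    intro h
    have h2 := exteriorPower.map_apply_ιMulti L.lag.subtype b
    rw [h, map_zero] at h2
    exact IsLagrangian.ιMulti_basis_ne_zero b h2.symm
  obtain ⟨c, hc⟩ := (finrank_eq_one_iff_of_nonzero' _ h0).1 h1 o
  have hL : L.orient = c • exteriorPower.ιMulti F (halfDim V) (fun i => (b i : V)) := by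
    rw [← ho, ← hc, map_smul, exteriorPower.map_apply_ιMulti]
    rfl
  refine ⟨c, ?_, hL⟩
  rintro rfl
  exact L.orient_ne_zero (by rw [hL, zero_smul])

/-- The Gram matrix of the symplectic form for two families of vectors. -/
def gram {ι κ : Type*} (x : ι → V) (y : κ → V) : Matrix ι κ F :=
  Matrix.of fun i j => V.form (x i) (y j)

theorem wedgeForm_ιMulti (x y : Fin (halfDim V) → V) :
    wedgeForm V (exteriorPower.ιMulti F _ x) (exteriorPower.ιMulti F _ y) =
      (-1) ^ (halfDim V).choose 2 * (gram x y).det := by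
  rw [wedgeForm, exteriorPower.map_apply_ιMulti, exteriorPower.pairingDual_ιMulti_ιMulti,
    ← Matrix.det_transpose]
  rfl

theorem wedgeForm_smul (a b : F) (x y : ⋀[F]^(halfDim V) V) :
    wedgeForm V (a • x) (b • y) = a * b * wedgeForm V x y := by
  simp [wedgeForm]; ring

/-- The coefficient of the orientation relative to a basis. -/
theorem OLag.exists_coeff (L : OLag V) {ι : Type*} (e : Fin (halfDim V) ≃ ι)
    (b : Module.Basis ι F L.lag) : ∃ c : F, c ≠ 0 ∧
      L.orient = c • exteriorPower.ιMulti F (halfDim V) (fun i => (b (e i) : V)) := by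
  obtain ⟨c, hc, h⟩ := L.orient_eq_smul (b.reindex e.symm)
  refine ⟨c, hc, ?_⟩
  simpa using h

/-- `ω_∧(o_L, o_M)` in terms of bases. -/
theorem wedgeForm_orient {L M : OLag V} {ι : Type*} [Fintype ι] [DecidableEq ι]
    (e : Fin (halfDim V) ≃ ι) (l : Module.Basis ι F L.lag) (m : Module.Basis ι F M.lag) {a b : F}
    (hx : L.orient = a • exteriorPower.ιMulti F (halfDim V) (fun i => (l (e i) : V)))
    (hy : M.orient = b • exteriorPower.ιMulti F (halfDim V) (fun i => (m (e i) : V))) :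
    (-1) ^ (halfDim V).choose 2 * wedgeForm V L.orient M.orient =
      a * b * (gram (fun i => (l i : V)) (fun i => (m i : V))).det := by
  rw [hx, hy, wedgeForm_smul, wedgeForm_ιMulti]
  have h1 : gram (fun i => (l (e i) : V)) (fun i => (m (e i) : V)) =
    (gram (fun i => (l i : V)) (fun i => (m i : V))).submatrix e e := rfl
  rw [h1, Matrix.det_submatrix_equiv_self]
  -- The explicit sign cancels the one in the normalization of `ω_∧`.
  have h2 : ((-1 : F) ^ (halfDim V).choose 2) * (-1) ^ (halfDim V).choose 2 = 1 := by
    rw [← mul_pow]; simp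
  linear_combination (a * b * (gram (fun i => (l i : V)) (fun i => (m i : V))).det) * h2

end

/-! ### Gauss sums of quadratic forms -/

section

variable {F : Type v} [Field F] [Fintype F]

theorem card_ne_zero_complex : (Fintype.card F : ℂ) ≠ 0 := by
  exact_mod_cast Fintype.card_ne_zero

variable [DecidableEq F]

/-- Each `t` has `σ(t) + 1` square roots. -/
theorem sum_comp_sq (hF : ringChar F ≠ 2) (g : F → ℂ) :
    ∑ z : F, g (z ^ 2) = ∑ t : F, (((quadraticChar F t : ℤ) : ℂ) + 1) * g t := by
  have h1 : ∀ t : F, (((quadraticChar F t : ℤ) : ℂ) + 1) * g t =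
      ∑ z ∈ Finset.univ.filter (fun z : F => z ^ 2 = t), g (z ^ 2) := by
    intro t
    rw [Finset.sum_congr rfl (g := fun _ => g t)
      (fun z hz => by rw [(Finset.mem_filter.1 hz).2]), Finset.sum_const, nsmul_eq_mul]
    congr 1
    have h := quadraticChar_card_sqrts hF t
    have h2 : ({x : F | x ^ 2 = t} : Set F).toFinset =
        Finset.univ.filter (fun z : F => z ^ 2 = t) := by ext; simp
    rw [h2] at h
    exact_mod_cast h.symm
  rw [Finset.sum_congr rfl fun t _ => h1 t]
  exact (Finset.sum_fiberwise _ _ _).symm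

/-- The quadratic character with complex values. -/
def quadraticCharC (F : Type v) [Field F] [Fintype F] [DecidableEq F] : MulChar F ℂ :=
  (quadraticChar F).ringHomComp (Int.castRingHom ℂ)

theorem quadraticCharC_apply (a : F) : quadraticCharC F a = ((quadraticChar F a : ℤ) : ℂ) := rfl

theorem quadraticCharC_isQuadratic : (quadraticCharC F).IsQuadratic :=
  (quadraticChar_isQuadratic F).comp _

theorem quadraticCharC_ne_one (hF : ringChar F ≠ 2) : quadraticCharC F ≠ 1 :=
  (MulChar.ringHomComp_ne_one_iff (RingHom.injective_int (Int.castRingHom ℂ))).2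
    (quadraticChar_ne_one hF)

theorem quadraticCharC_sq {a : F} (ha : a ≠ 0) : quadraticCharC F a ^ 2 = 1 := by
  rw [quadraticCharC_apply, ← Int.cast_pow, quadraticChar_sq_one ha, Int.cast_one]

theorem quadraticCharC_mul_self {a : F} (ha : a ≠ 0) :
    quadraticCharC F a * quadraticCharC F a = 1 := by
  rw [← pow_two, quadraticCharC_sq ha]

variable {ψ : AddChar F ℂ}

/-- In `sum_comp_sq` the summand `1` contributes the full sum of a non-trivial character, which
vanishes; the rest is a Gauss sum with shifted character. -/
theorem sum_addChar_mul_sq (hF : ringChar F ≠ 2) (hψ : ψ ≠ 1) {a : F} (ha : a ≠ 0) :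
    ∑ z : F, ψ (a * z ^ 2) = quadraticCharC F a * gaussSum (quadraticCharC F) ψ := by
  rw [sum_comp_sq hF fun t => ψ (a * t)]
  simp only [add_mul, one_mul, Finset.sum_add_distrib]
  have h1 : ∑ t : F, ψ (a * t) = 0 := by
    rw [← AddChar.sum_eq_zero_of_ne_one hψ]
    exact Fintype.sum_equiv (Equiv.mulLeft₀ a ha) _ _ fun _ => rfl
  have h2 := gaussSum_mulShift_eq (quadraticCharC F) ψ (Units.mk0 a ha)
  rw [quadraticCharC_isQuadratic.inv, Units.val_mk0] at h2
  rw [h1, add_zero, ← h2]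
  rfl

theorem gauss_eq (hF : ringChar F ≠ 2) (hψ : ψ ≠ 1) :
    gauss ψ = quadraticCharC F 2⁻¹ * gaussSum (quadraticCharC F) ψ :=
  sum_addChar_mul_sq hF hψ (inv_ne_zero (Ring.two_ne_zero hF))

theorem sum_addChar_half_mul_sq (hF : ringChar F ≠ 2) (hψ : ψ ≠ 1) {a : F} (ha : a ≠ 0) :
    ∑ z : F, ψ ((2 : F)⁻¹ * (a * z ^ 2)) = quadraticCharC F a * gauss ψ := by
  have h2 := inv_ne_zero (Ring.two_ne_zero hF)
  rw [gauss_eq hF hψ, ← mul_assoc, ← map_mul, mul_comm a,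
    ← sum_addChar_mul_sq hF hψ (mul_ne_zero h2 ha)]
  simp only [mul_assoc]

theorem gauss_sq (hF : ringChar F ≠ 2) (hψ : ψ ≠ 1) :
    gauss ψ ^ 2 = quadraticCharC F (-1) * Fintype.card F := by
  rw [gauss_eq hF hψ, mul_pow,
    quadraticCharC_sq (inv_ne_zero (Ring.two_ne_zero hF)), one_mul]
  exact gaussSum_sq (quadraticCharC_ne_one hF) quadraticCharC_isQuadratic
    (AddChar.IsPrimitive.of_ne_one hψ)

theorem gauss_ne_zero (hF : ringChar F ≠ 2) (hψ : ψ ≠ 1) : gauss ψ ≠ 0 := by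
  intro h
  have h1 := gauss_sq hF hψ
  have h2 := quadraticCharC_sq (F := F) (neg_ne_zero.2 one_ne_zero : (-1 : F) ≠ 0)
  rw [h, zero_pow two_ne_zero] at h1
  rcases mul_eq_zero.1 h1.symm with h3 | h3
  · rw [h3] at h2; simp at h2
  · exact card_ne_zero_complex h3

/-- A quadratic Gauss sum in several variables, diagonal case. -/
theorem sum_addChar_diagonal (hF : ringChar F ≠ 2) (hψ : ψ ≠ 1) {ι : Type*} [Fintype ι]
    [DecidableEq ι] (d : ι → F) (hd : ∀ i, d i ≠ 0) :
    ∑ y : ι → F, ψ ((2 : F)⁻¹ * ∑ i, d i * y i ^ 2) =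
      quadraticCharC F (∏ i, d i) * gauss ψ ^ Fintype.card ι := by
  rw [map_prod, ← Finset.card_univ, ← Finset.prod_const, ← Finset.prod_mul_distrib]
  rw [Finset.prod_congr rfl fun i _ => (sum_addChar_half_mul_sq hF hψ (hd i)).symm,
    Finset.prod_univ_sum, Fintype.piFinset_univ]
  refine Finset.sum_congr rfl fun y _ => ?_
  rw [Finset.mul_sum]
  exact map_prod ψ.toMonoidHom (fun i => Multiplicative.ofAdd ((2 : F)⁻¹ * (d i * y i ^ 2))) _

/-- A quadratic Gauss sum in several variables. -/
theorem sum_addChar_toBilin (hF : ringChar F ≠ 2) (hψ : ψ ≠ 1) {ι : Type*} [Fintype ι]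
    [DecidableEq ι] {D : Matrix ι ι F} (hD : D.IsSymm) (hdet : D.det ≠ 0) :
    ∑ y : ι → F, ψ ((2 : F)⁻¹ * Matrix.toBilin' D y y) =
      quadraticCharC F D.det * gauss ψ ^ Fintype.card ι := by
  have h2 := Ring.two_ne_zero hF
  have : Invertible (2 : F) := invertibleOfNonzero h2
  set B := Matrix.toBilin' D with hB
  have hBs : LinearMap.IsSymm B := ⟨fun x y => by
    simp only [hB, Matrix.toBilin'_apply, RingHom.id_apply]
    rw [Finset.sum_comm]
    refine Finset.sum_congr rfl fun i _ => Finset.sum_congr rfl fun j _ => ?_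
    rw [← hD.apply i j]; ring⟩
  obtain ⟨v₀, hv₀⟩ := LinearMap.BilinForm.exists_orthogonal_basis hBs
  have hcard : Module.finrank F (ι → F) = Fintype.card ι := by simp
  let e : Fin (Module.finrank F (ι → F)) ≃ ι := (Fintype.equivFinOfCardEq hcard.symm).symm
  let v := v₀.reindex e
  have hv : ∀ i j, i ≠ j → B (v i) (v j) = 0 := by
    intro i j hij
    simp only [v, Module.Basis.reindex_apply]
    exact hv₀ (fun h => hij (e.symm.injective h))
  have hdiag : LinearMap.BilinForm.toMatrix v B = Matrix.diagonal fun i => B (v i) (v i) := by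
    ext i j
    rw [LinearMap.BilinForm.toMatrix_apply]
    by_cases hij : i = j
    · subst hij; simp
    · rw [Matrix.diagonal_apply_ne _ hij, hv i j hij]
  have hmul := LinearMap.BilinForm.toMatrix_mul_basis_toMatrix (Pi.basisFun F ι) v B
  have hD' : LinearMap.BilinForm.toMatrix (Pi.basisFun F ι) B = D := by
    ext i j
    rw [LinearMap.BilinForm.toMatrix_apply]
    simp [hB, Matrix.toBilin'_single]
  set P := (Pi.basisFun F ι).toMatrix v with hP
  have hPdet : P.det ≠ 0 := by
    have := congrArg Matrix.det ((Pi.basisFun F ι).toMatrix_mul_toMatrix_flip v)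
    rw [Matrix.det_mul, Matrix.det_one] at this
    exact left_ne_zero_of_mul_eq_one this
  rw [hD', hdiag] at hmul
  -- The diagonal Gram matrix is `Pᵀ D P`, so its determinant differs from `det D` by a square,
  -- invisible to `σ`.
  have hdet' := congrArg Matrix.det hmul
  rw [Matrix.det_mul, Matrix.det_mul, Matrix.det_transpose, Matrix.det_diagonal] at hdet'
  have hprod : ∏ i, B (v i) (v i) ≠ 0 := by
    rw [← hdet']
    exact mul_ne_zero (mul_ne_zero hPdet hdet) hPdet
  have hchar : quadraticCharC F D.det = quadraticCharC F (∏ i, B (v i) (v i)) := by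
    rw [← hdet', map_mul, map_mul, mul_right_comm, quadraticCharC_mul_self hPdet, one_mul]
  rw [hchar, ← sum_addChar_diagonal hF hψ _ (fun i => Finset.prod_ne_zero_iff.1 hprod i
    (Finset.mem_univ i))]
  refine (Fintype.sum_equiv v.equivFun.symm.toEquiv _ _ fun y => ?_).symm
  congr 2
  simp only [LinearEquiv.coe_toEquiv, Module.Basis.equivFun_symm_apply, map_sum,
    LinearMap.sum_apply, map_smul, LinearMap.smul_apply, smul_eq_mul]
  refine Finset.sum_congr rfl fun i _ => ?_
  rw [Finset.sum_eq_single i]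
  · ring
  · intro j _ hj
    rw [hv j i hj]; ring
  · intro h; exact absurd (Finset.mem_univ i) h

end

/-! ### Pairs of Lagrangians and adapted bases -/

section

variable {F : Type v} [Field F]

/-- The new vectors form a basis of a complement of `I` in `L`, hence are independent modulo `I`. -/
theorem exists_basis_extending {E : Type*} [AddCommGroup E] [Module F E] [FiniteDimensional F E]
    {I L : Submodule F E} (hIL : I ≤ L) {k m : ℕ} (u : Module.Basis (Fin k) F I)
    (h : Module.finrank F L = k + m) :
    ∃ l : Module.Basis (Fin k ⊕ Fin m) F L, (∀ i, (l (Sum.inl i) : E) = u i) ∧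
      ∀ y : Fin m → F, ∑ j, y j • (l (Sum.inr j) : E) ∈ I → y = 0 := by
  let J : Submodule F L := I.comap L.subtype
  obtain ⟨C, hC⟩ := J.exists_isCompl
  let eI : J ≃ₗ[F] I := Submodule.comapSubtypeEquivOfLe hIL
  have hJ : Module.finrank F J = k := by
    rw [eI.finrank_eq, Module.finrank_eq_card_basis u, Fintype.card_fin]
  have hCm : Module.finrank F C = m := by
    have := Submodule.finrank_add_eq_of_isCompl hC
    omega
  let c := Module.finBasisOfFinrankEq F C hCm
  let l := ((u.map eI.symm).prod c).map (Submodule.prodEquivOfIsCompl J C hC)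
  have hr : ∀ j, l (Sum.inr j) = (c j : L) := fun j => by simp [l]
  refine ⟨l, fun i => ?_, fun y hy => ?_⟩
  · simp [l, eI, Submodule.comapSubtypeEquivOfLe]
  · have h1 : (∑ j, y j • c j : C) = 0 := by
      have h2 : ((∑ j, y j • c j : C) : L) ∈ J := by
        simpa [J, hr] using hy
      have h3 : ((∑ j, y j • c j : C) : L) ∈ J ⊓ C := ⟨h2, Subtype.property _⟩
      rw [hC.inf_eq_bot, Submodule.mem_bot] at h3
      exact Subtype.ext h3
    exact funext (Fintype.linearIndependent_iff.1 c.linearIndependent y h1)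

variable {V : Symp.{u, v} F}

/-- Both bases extend one basis of `L ∩ N`, of dimension `k`. This splits off the radical of the
quadratic form on `N` studied below. -/
theorem exists_adapted_bases {L N : Submodule F V} (hL : IsLagrangian V L)
    (hN : IsLagrangian V N) :
    ∃ (k m : ℕ) (l : Module.Basis (Fin k ⊕ Fin m) F L) (e : Module.Basis (Fin k ⊕ Fin m) F N),
      (∀ i, (e (Sum.inl i) : V) = l (Sum.inl i)) ∧
      (∀ y : Fin m → F, ∑ j, y j • (e (Sum.inr j) : V) ∈ L → y = 0) ∧
      (L ⊔ N = ⊤ → k = 0) := by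
  let u := Module.finBasis F (L ⊓ N : Submodule F V)
  have hk := Submodule.finrank_mono (inf_le_left : L ⊓ N ≤ L)
  obtain ⟨m, hm⟩ := Nat.exists_eq_add_of_le hk
  have hm' : Module.finrank F N = Module.finrank F (L ⊓ N : Submodule F V) + m := by
    rw [hN.finrank_eq, ← hL.finrank_eq, hm]
  obtain ⟨l, hl, -⟩ := exists_basis_extending inf_le_left u hm
  obtain ⟨e, he, he'⟩ := exists_basis_extending inf_le_right u hm'
  refine ⟨_, m, l, e, fun i => (he i).trans (hl i).symm, fun y hy => he' y ⟨hy, ?_⟩, fun h => ?_⟩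
  · exact Submodule.sum_mem _ fun j _ => Submodule.smul_mem _ _ (Subtype.property _)
  · rw [(hL.sup_eq_top_iff hN).1 h, finrank_bot]

theorem mem_of_basis_orthogonal {N : Submodule F V} (hN : IsLagrangian V N) {ι : Type*}
    (e : Module.Basis ι F N) {x : V} (h : ∀ i, V.form (e i) x = 0) : x ∈ N := by
  rw [← hN]
  have h2 : ((V.form.flip x).comp N.subtype) = 0 := e.ext fun i => h i
  exact fun n hn => LinearMap.congr_fun h2 ⟨n, hn⟩

theorem gram_mulVec {ι κ : Type*} [Fintype κ] (x : ι → V) (y : κ → V) (c : κ → F) (i : ι) :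
    (gram x y).mulVec c i = V.form (x i) (∑ j, c j • y j) := by
  simp [gram, Matrix.mulVec, dotProduct, mul_comm]

/-- A kernel vector would give an element of `S` orthogonal to `N`, hence in `N ∩ S = 0`. -/
theorem det_gram_ne_zero {N S : Submodule F V} (hN : IsLagrangian V N)
    (hNS : N ⊓ S = ⊥) {ι : Type*} [Fintype ι] [DecidableEq ι] (e : Module.Basis ι F N)
    (s : Module.Basis ι F S) : (gram (fun i => (e i : V)) (fun i => (s i : V))).det ≠ 0 := by
  intro h
  obtain ⟨c, hc, hc'⟩ := Matrix.exists_mulVec_eq_zero_iff.2 h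
  refine hc ?_
  have h1 : ((∑ j, c j • s j : S) : V) ∈ N ⊓ S := by
    refine ⟨mem_of_basis_orthogonal hN e fun i => ?_, Subtype.property _⟩
    have := congrFun hc' i
    rw [gram_mulVec] at this
    simpa using this
  rw [hNS, Submodule.mem_bot] at h1
  exact funext (Fintype.linearIndependent_iff.1 s.linearIndependent c (Subtype.ext h1))

theorem gram_swap {ι κ : Type*} (x : ι → V) (y : κ → V) : gram y x = -(gram x y).transpose := by
  ext i j
  exact form_swap _ _

theorem IsLagrangian.form_eq_zero {L : Submodule F V} (hL : IsLagrangian V L) {x y : V}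
    (hx : x ∈ L) (hy : y ∈ L) : V.form x y = 0 := by
  have h : y ∈ V.form.orthogonal L := by rw [hL]; exact hy
  exact h x hx

/-- The projection onto `S` along `L` can be dropped after pairing with `L`. -/
theorem form_projectionOnto {L S : Submodule F V} (hL : IsLagrangian V L) (h : IsCompl S L)
    {x : V} (hx : x ∈ L) (y : V) : V.form x (S.projectionOnto L h y : V) = V.form x y := by
  have h1 : y - (S.projectionOnto L h y : V) ∈ L := by
    rw [← Submodule.projectionOnto_apply_eq_zero_iff h, map_sub,
      Submodule.projectionOnto_apply_left, sub_self]
  have h2 := hL.form_eq_zero hx h1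
  rw [map_sub, sub_eq_zero] at h2
  exact h2.symm

/-- `ω(x, b y)` is symmetric in `x, y` in a Lagrangian, `b` being the projection to one Lagrangian
along another. -/
theorem form_projectionOnto_symm {L S N : Submodule F V} (hL : IsLagrangian V L)
    (hS : IsLagrangian V S) (hN : IsLagrangian V N) (h : IsCompl S L) {x y : V} (hx : x ∈ N)
    (hy : y ∈ N) :
    V.form x (S.projectionOnto L h y : V) = V.form y (S.projectionOnto L h x : V) := by
  have h1 : ∀ z : V, z - (S.projectionOnto L h z : V) ∈ L := fun z => by
    rw [← Submodule.projectionOnto_apply_eq_zero_iff h, map_sub,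
      Submodule.projectionOnto_apply_left, sub_self]
  -- Expanding `ω(x - p x, y - p y) = 0` leaves only the mixed terms, since `ω(x, y) = 0` and `ω(p
  -- x, p y) = 0`.
  have h2 := hL.form_eq_zero (h1 x) (h1 y)
  have h3 := hS.form_eq_zero (S.projectionOnto L h x).2 (S.projectionOnto L h y).2
  have h4 := hN.form_eq_zero hx hy
  have h5 := form_swap (y : V) (S.projectionOnto L h x : V)
  simp only [map_sub, LinearMap.sub_apply] at h2
  rw [h3, h4, h5] at *
  linear_combination -h2

/-- The matrix of the quadratic form `ω(x, b x)` on the part of an adapted basis outside `L`. -/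
def projGram {L S : Submodule F V} (h : IsCompl S L) {m : ℕ} (g : Fin m → V) :
    Matrix (Fin m) (Fin m) F :=
  gram g fun j => (S.projectionOnto L h (g j) : V)

section Adapted

variable {L S N : Submodule F V} {k m : ℕ} {l : Module.Basis (Fin k ⊕ Fin m) F L}
  {e : Module.Basis (Fin k ⊕ Fin m) F N}

/-- Vectors of `L ∩ N` lie in the radical of `ω(x, p y)` on `N`. -/
theorem form_adapted_inl (hL : IsLagrangian V L) (hN : IsLagrangian V N) (hSL : IsCompl S L)
    (hel : ∀ i, (e (Sum.inl i) : V) = l (Sum.inl i)) (i : Fin k) {y : V} (hy : y ∈ N) :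
    V.form (e (Sum.inl i) : V) (S.projectionOnto L hSL y : V) = 0 := by
  rw [form_projectionOnto hL hSL (by rw [hel]; exact Subtype.property _)]
  exact hN.form_eq_zero (Subtype.property _) hy

/-- For a combination `x` in the kernel, `p x` is orthogonal to all of `N`, so `p x ∈ N ∩ S = 0` and
`x ∈ L`; the vectors are independent modulo `L`. -/
theorem projGram_det_ne_zero (hL : IsLagrangian V L) (hN : IsLagrangian V N)
    (hSL : IsCompl S L) (hSN : N ⊓ S = ⊥)
    (hel : ∀ i, (e (Sum.inl i) : V) = l (Sum.inl i))
    (he : ∀ y : Fin m → F, ∑ j, y j • (e (Sum.inr j) : V) ∈ L → y = 0) :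
    (projGram hSL fun j => (e (Sum.inr j) : V)).det ≠ 0 := by
  intro h
  obtain ⟨c, hc, hc'⟩ := Matrix.exists_mulVec_eq_zero_iff.2 h
  refine hc (he c ?_)
  set x : V := ∑ j, c j • (e (Sum.inr j) : V) with hx
  have hxN : x ∈ N := Submodule.sum_mem _ fun j _ => Submodule.smul_mem _ _ (Subtype.property _)
  have h1 : (S.projectionOnto L hSL x : V) ∈ N ⊓ S := by
    refine ⟨mem_of_basis_orthogonal hN e fun i => ?_, Subtype.property _⟩
    rcases i with i | i
    · exact form_adapted_inl hL hN hSL hel i hxN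
    · have := congrFun hc' i
      rw [projGram, gram_mulVec] at this
      simpa [hx] using this
  rw [hSN, Submodule.mem_bot] at h1
  rw [← Submodule.projectionOnto_apply_eq_zero_iff hSL]
  exact Subtype.ext h1

/-- One matrix `C` makes both Gram matrices against `S` block triangular: `W C` has diagonal blocks
`1`, `D`, and `X C` has diagonal blocks `1` and the pairing of the two complements. Multiplying the
determinants gives the claim with `c = det C`. -/
theorem det_gram_mul_det_gram (hL : IsLagrangian V L) (hN : IsLagrangian V N)
    (hSL : IsCompl S L) (hSN : N ⊓ S = ⊥)
    (hel : ∀ i, (e (Sum.inl i) : V) = l (Sum.inl i))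
    (he : ∀ y : Fin m → F, ∑ j, y j • (e (Sum.inr j) : V) ∈ L → y = 0)
    (s : Module.Basis (Fin k ⊕ Fin m) F S) :
    ∃ c : F, c ≠ 0 ∧ (gram (fun i => (l i : V)) (fun i => (s i : V))).det *
        (gram (fun i => (e i : V)) (fun i => (s i : V))).det * c ^ 2 =
      (projGram hSL fun j => (e (Sum.inr j) : V)).det *
        (gram (fun i => (l (Sum.inr i) : V)) (fun j => (e (Sum.inr j) : V))).det := by
  set W := gram (fun i => (e i : V)) (fun i => (s i : V)) with hW
  set X := gram (fun i => (l i : V)) (fun i => (s i : V)) with hX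
  set D := projGram hSL fun j => (e (Sum.inr j) : V) with hD
  have hWdet : W.det ≠ 0 := det_gram_ne_zero hN hSN e s
  have hDdet : D.det ≠ 0 := projGram_det_ne_zero hL hN hSL hSN hel he
  -- The first `k` columns come from `W⁻¹`; the others are the coordinates in `s` of the projections
  -- `p eⱼ`.
  let C : Matrix (Fin k ⊕ Fin m) (Fin k ⊕ Fin m) F := Matrix.of fun r c =>
    Sum.elim (fun i => W⁻¹ r (Sum.inl i))
      (fun j => s.repr (S.projectionOnto L hSL (e (Sum.inr j) : V)) r) c
  have hcol : ∀ (x : Fin k ⊕ Fin m → V) i j,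
      (gram x (fun i => (s i : V)) * C) i (Sum.inr j) =
        V.form (x i) (S.projectionOnto L hSL (e (Sum.inr j) : V) : V) := by
    intro x i j
    have h1 : (S.projectionOnto L hSL (e (Sum.inr j) : V) : V) =
        ∑ r, C r (Sum.inr j) • (s r : V) := by
      have h2 := congrArg S.subtype
        (s.sum_repr (S.projectionOnto L hSL (e (Sum.inr j) : V))).symm
      rw [map_sum] at h2
      exact h2
    rw [h1, ← gram_mulVec]
    rfl
  have hcol' : ∀ i j, (W * C) i (Sum.inl j) =
      (1 : Matrix (Fin k ⊕ Fin m) (Fin k ⊕ Fin m) F) i (Sum.inl j) := by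
    intro i j
    rw [← Matrix.mul_nonsing_inv W hWdet.isUnit]
    rfl
  have hWC : W * C = Matrix.fromBlocks 1 0 0 D := by
    ext i (j | j)
    · rw [hcol']
      rcases i with i | i <;> simp [Matrix.one_apply]
    · rw [hW, hcol]
      rcases i with i | i
      · exact form_adapted_inl hL hN hSL hel i (Subtype.property _)
      · rfl
  have hXC : X * C = Matrix.fromBlocks 1 0 (X * C).toBlocks₂₁
      (gram (fun i => (l (Sum.inr i) : V)) (fun j => (e (Sum.inr j) : V))) := by
    -- The bases of `L` and `N` share their first `k` vectors.
    have hrow : ∀ i j, (X * C) (Sum.inl i) j = (W * C) (Sum.inl i) j := by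
      intro i j
      simp only [Matrix.mul_apply, hX, hW, gram, Matrix.of_apply, hel]
    ext (i | i) (j | j)
    · rw [hrow, hWC]; simp
    · rw [hrow, hWC]; simp
    · rfl
    · rw [hX, hcol, form_projectionOnto hL hSL (Subtype.property _)]
      rfl
  have d1 := congrArg Matrix.det hWC
  have d2 := congrArg Matrix.det hXC
  rw [Matrix.det_mul, Matrix.det_fromBlocks_zero₁₂, Matrix.det_one, one_mul] at d1 d2
  refine ⟨C.det, fun h => hDdet (by rw [← d1, h, mul_zero]), ?_⟩
  rw [← d1, ← d2]
  ring

variable [Fintype F] [DecidableEq F] {ψ : AddChar F ℂ}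

/-- The `k` coordinates along the radical `L ∩ N` are free and give `q^k`; the other `m` carry a
non-degenerate quadratic form. -/
theorem sum_addChar_projectionOnto (hF : ringChar F ≠ 2) (hψ : ψ ≠ 1) (hL : IsLagrangian V L)
    (hS : IsLagrangian V S) (hN : IsLagrangian V N)
    (hSL : IsCompl S L) (hSN : N ⊓ S = ⊥) [Fintype N]
    (hel : ∀ i, (e (Sum.inl i) : V) = l (Sum.inl i))
    (he : ∀ y : Fin m → F, ∑ j, y j • (e (Sum.inr j) : V) ∈ L → y = 0) :
    ∑ x : N, ψ ((2 : F)⁻¹ * V.form x (S.projectionOnto L hSL x : V)) =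
      (Fintype.card F : ℂ) ^ k *
        (quadraticCharC F (projGram hSL fun j => (e (Sum.inr j) : V)).det * gauss ψ ^ m) := by
  set D := projGram hSL fun j => (e (Sum.inr j) : V) with hD
  have hDs : D.IsSymm := by
    ext i j
    exact form_projectionOnto_symm hL hS hN hSL (Subtype.property _) (Subtype.property _)
  have hG := sum_addChar_toBilin hF hψ hDs (projGram_det_ne_zero hL hN hSL hSN hel he)
  rw [Fintype.card_fin] at hG
  rw [← hG]
  have hc : (Fintype.card F : ℂ) ^ k = ∑ _x : Fin k → F, (1 : ℂ) := by simp
  rw [hc, Finset.sum_mul_sum, ← Fintype.sum_prod_type']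
  let E : N ≃ (Fin k → F) × (Fin m → F) :=
    e.equivFun.toEquiv.trans (Equiv.sumArrowEquivProdArrow _ _ _)
  refine (Fintype.sum_equiv E.symm _ _ fun p => ?_).symm
  obtain ⟨x, y⟩ := p
  rw [one_mul]
  congr 2
  set g : V := ∑ j, y j • (e (Sum.inr j) : V) with hg
  set w : V := ∑ i, x i • (e (Sum.inl i) : V) with hw
  have hE : ((E.symm (x, y) : N) : V) = w + g := by
    simp [E, Module.Basis.equivFun_symm_apply, hw, hg, Equiv.sumArrowEquivProdArrow]
  have hwL : w ∈ L := Submodule.sum_mem _ fun j _ => Submodule.smul_mem _ _ (by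
    rw [hel]; exact Subtype.property _)
  have hwN : w ∈ N := Submodule.sum_mem _ fun j _ => Submodule.smul_mem _ _ (Subtype.property _)
  have hgN : g ∈ N := Submodule.sum_mem _ fun j _ => Submodule.smul_mem _ _ (Subtype.property _)
  rw [hE, map_add (S.projectionOnto L hSL) w g,
    (Submodule.projectionOnto_apply_eq_zero_iff hSL).2 hwL, zero_add, map_add V.form w g,
    LinearMap.add_apply, form_projectionOnto hL hSL hwL, hN.form_eq_zero hwN hgN, zero_add]
  rw [Matrix.toBilin'_apply, hg]
  simp only [map_sum, LinearMap.sum_apply, map_smul, LinearMap.smul_apply, smul_eq_mul,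
    Submodule.coe_sum, Submodule.coe_smul, Finset.mul_sum]
  rw [Finset.sum_comm]
  refine Finset.sum_congr rfl fun i _ => Finset.sum_congr rfl fun j _ => ?_
  simp only [hD, projGram, gram, Matrix.of_apply]
  ring

end Adapted

end

/-! ### Vectors invariant under a Lagrangian -/

section

variable {F : Type v} [Field F] {V : Symp.{u, v} F} {ψ : AddChar F ℂ}

namespace Fibre

variable {L M : OLag V}

theorem apply_eq (f : Fibre ψ L) (h : Heis V) : f.1 h = ψ h.cen * f.1 (Heis.ofVec h.vec) := by
  rw [← f.2.1]
  refine congrArg f.1 (Heis.ext ?_ ?_) <;> simp [Heis.ofCenter, Heis.ofVec]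

theorem apply_of_mem (f : Fibre ψ L) {h : Heis V} (hh : h.vec ∈ L.lag) :
    f.1 h = ψ h.cen * f.1 1 := by
  rw [apply_eq, ← f.2.2 h.vec hh 1, mul_one]

open Classical in
/-- The function in `ℋ_L` supported on `L · Z` with value `1` at the identity. -/
def delta (ψ : AddChar F ℂ) (L : OLag V) : Fibre ψ L :=
  ⟨fun h => if h.vec ∈ L.lag then ψ h.cen else 0, by
    constructor
    · intro z h
      simp [Heis.ofCenter, AddChar.map_add_eq_mul]
    · intro l hl h
      by_cases hh : h.vec ∈ L.lag
      · simp [Heis.ofVec, hh, L.lag.add_mem hl hh, L.form_eq_zero hl hh]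
      · simp [Heis.ofVec, hh, L.lag.add_mem_iff_right hl]⟩

theorem delta_apply_of_mem {h : Heis V} (hh : h.vec ∈ L.lag) : (delta ψ L).1 h = ψ h.cen :=
  if_pos hh

theorem delta_apply_of_notMem {h : Heis V} (hh : h.vec ∉ L.lag) : (delta ψ L).1 h = 0 :=
  if_neg hh

theorem delta_one : (delta ψ L).1 1 = 1 := by
  rw [delta_apply_of_mem (by simp)]
  simp

theorem fibreRep_apply (h h' : Heis V) (f : Fibre ψ L) :
    (fibreRep ψ L h f).1 h' = f.1 (h' * h) := rfl

theorem delta_invariant (l : L.lag) : fibreRep ψ L (Heis.ofVec l.1) (delta ψ L) = delta ψ L := by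
  ext h
  rw [fibreRep_apply]
  by_cases hh : h.vec ∈ L.lag
  · rw [delta_apply_of_mem hh, delta_apply_of_mem]
    · simp [Heis.ofVec, L.form_eq_zero hh l.2]
    · exact L.lag.add_mem hh l.2
  · rw [delta_apply_of_notMem hh, delta_apply_of_notMem]
    exact fun h' => hh ((L.lag.add_mem_iff_left l.2).1 h')

end Fibre

theorem Heis.mul_ofVec_comm (hF : (2 : F) ≠ 0) (h : Heis V) (v : V) :
    h * Heis.ofVec v = Heis.ofCenter (V.form h.vec v) * (Heis.ofVec v * h) := by
  ext
  · simp [Heis.ofVec, Heis.ofCenter, add_comm]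
  · simp only [Heis.ofVec, Heis.ofCenter, Heis.mul_cen, Heis.mul_vec, map_zero,
      LinearMap.zero_apply, form_swap v h.vec]
    field_simp
    ring

variable [Fintype F] {L M : OLag V}

open Classical in
-- `l ↦ ψ(ω(x, l))` is a character of `L`, trivial exactly when `x` is orthogonal to `L`, that is,
-- when `x ∈ L`.
theorem sum_addChar_form (hψ : ψ ≠ 1) (L : OLag V) (x : V) :
    ∑ l : L.lag, ψ (V.form x l) = if x ∈ L.lag then (Fintype.card L.lag : ℂ) else 0 := by
  split_ifs with hx
  · rw [Finset.sum_congr rfl (g := fun _ => (1 : ℂ)) fun l _ => by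
      rw [L.form_eq_zero hx l.2, AddChar.map_zero_eq_one]]
    simp
  · let φ : L.lag →+ F := ((V.form x).comp L.lag.subtype).toAddMonoidHom
    have hne : ψ.compAddMonoidHom φ ≠ 1 := by
      obtain ⟨l, hl, hl0⟩ : ∃ l ∈ L.lag, V.form x l ≠ 0 := by
        by_contra! hcon
        apply hx
        rw [← L.isLagrangian]
        intro l hl
        have := hcon l hl
        rw [form_swap, neg_eq_zero] at this
        exact this
      obtain ⟨z, hz⟩ := AddChar.ne_one_iff.1 hψ
      refine AddChar.ne_one_iff.2 ⟨(z / V.form x l) • ⟨l, hl⟩, ?_⟩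
      have : φ ((z / V.form x l) • ⟨l, hl⟩) = z := by
        simp [φ, hl0]
      rwa [AddChar.compAddMonoidHom_apply, this]
    exact AddChar.sum_eq_zero_of_ne_one hne

theorem card_lag_ne_zero (L : OLag V) : (Fintype.card L.lag : ℂ) ≠ 0 := by
  exact_mod_cast Fintype.card_ne_zero

theorem card_lag (L : OLag V) : (Fintype.card L.lag : ℂ) = (Fintype.card F : ℂ) ^ halfDim V := by
  rw [Module.card_eq_pow_finrank (K := F) (V := L.lag), L.isLagrangian.finrank_eq]
  push_cast
  rfl

/-- Translation by `l` multiplies the value at `h` by `ψ(ω(h, l))`, so summing over `L` kills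
everything off `L · Z`, where `f` is determined by `f(1)`. Hence the `L`-invariants form the line of
the delta function. -/
theorem Fibre.sum_fibreRep (hF : (2 : F) ≠ 0) (hψ : ψ ≠ 1) (f : Fibre ψ L) :
    ∑ l : L.lag, fibreRep ψ L (Heis.ofVec l.1) f =
      ((Fintype.card L.lag : ℂ) * f.1 1) • Fibre.delta ψ L := by
  classical
  ext h
  have h1 : (∑ l : L.lag, fibreRep ψ L (Heis.ofVec l.1) f).1 h =
      (∑ l : L.lag, ψ (V.form h.vec l)) * f.1 h := by
    rw [Submodule.coe_sum, Finset.sum_apply, Finset.sum_mul]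
    refine Finset.sum_congr rfl fun l _ => ?_
    rw [Fibre.fibreRep_apply, Heis.mul_ofVec_comm hF, f.2.1, f.2.2 l.1 l.2]
  rw [h1, sum_addChar_form hψ]
  change _ = _ * (Fibre.delta ψ L).1 h
  split_ifs with hh
  · rw [Fibre.delta_apply_of_mem hh, Fibre.apply_of_mem f hh]; ring
  · rw [Fibre.delta_apply_of_notMem hh, zero_mul, mul_zero]

theorem Fibre.eq_sum_delta [Fintype V] (f : Fibre ψ L) :
    (Fintype.card L.lag : ℂ) • f =
      ∑ x : V, f.1 (Heis.ofVec x) • fibreRep ψ L (Heis.ofVec (-x)) (Fibre.delta ψ L) := by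
  classical
  ext h
  have h1 : (∑ x : V, f.1 (Heis.ofVec x) •
        fibreRep ψ L (Heis.ofVec (-x)) (Fibre.delta ψ L)).1 h =
      ∑ x : V, f.1 (Heis.ofVec x) * (Fibre.delta ψ L).1 (h * Heis.ofVec (-x)) := by
    rw [Submodule.coe_sum, Finset.sum_apply]
    rfl
  -- With `y = h.vec - x` only `y ∈ L` contributes, each time `f(h)`.
  rw [h1, ← Fintype.sum_equiv (Equiv.subLeft h.vec)
    (fun y => f.1 (Heis.ofVec (h.vec - y)) * (Fibre.delta ψ L).1 (h * Heis.ofVec (-(h.vec - y)))) _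
    (fun y => rfl)]
  have h2 : ∀ y : V, f.1 (Heis.ofVec (h.vec - y)) *
      (Fibre.delta ψ L).1 (h * Heis.ofVec (-(h.vec - y))) = if y ∈ L.lag then f.1 h else 0 := by
    intro y
    have hv : (h * Heis.ofVec (-(h.vec - y))).vec = y := by simp [Heis.ofVec]
    split_ifs with hy
    · rw [Fibre.delta_apply_of_mem (by rwa [hv]), mul_comm, ← f.2.2 y hy (Heis.ofVec (h.vec - y)),
        ← f.2.1]
      refine congrArg f.1 (Heis.ext ?_ ?_)
      · simp [Heis.ofVec, Heis.ofCenter]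
      · simp [Heis.ofVec, Heis.ofCenter, V.isAlt h.vec, V.isAlt y, form_swap y h.vec]
    · rw [Fibre.delta_apply_of_notMem (by rwa [hv]), mul_zero]
  rw [Finset.sum_congr rfl fun y _ => h2 y, ← Finset.sum_filter, Finset.sum_const, nsmul_eq_mul]
  change _ * f.1 h = _
  congr 2
  rw [← Fintype.card_subtype]

/-- An endomorphism of the Heisenberg representation is a scalar. -/
theorem Fibre.end_eq_smul (hF : (2 : F) ≠ 0) (hψ : ψ ≠ 1) (Φ : Fibre ψ L →ₗ[ℂ] Fibre ψ L)
    (hΦ : ∀ h f, Φ (fibreRep ψ L h f) = fibreRep ψ L h (Φ f)) :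
    ∃ c : ℂ, ∀ f, Φ f = c • f := by
  have : Finite V := Module.finite_of_finite F
  have : Fintype V := Fintype.ofFinite V
  have hq := card_lag_ne_zero L
  have hδ : Φ (Fibre.delta ψ L) = (Φ (Fibre.delta ψ L)).1 1 • Fibre.delta ψ L := by
    -- The image of the `L`-invariant delta function is `L`-invariant, so its sum over `L` is `|L|`
    -- times itself.
    have h1 := Fibre.sum_fibreRep hF hψ (Φ (Fibre.delta ψ L))
    simp only [← hΦ, Fibre.delta_invariant] at h1
    rw [Finset.sum_const, Finset.card_univ, ← Nat.cast_smul_eq_nsmul ℂ, mul_smul] at h1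
    exact smul_right_injective _ hq h1
  refine ⟨(Φ (Fibre.delta ψ L)).1 1, fun f => smul_right_injective _ hq ?_⟩
  dsimp only
  rw [← map_smul, Fibre.eq_sum_delta f, smul_comm, Fibre.eq_sum_delta f, map_sum,
    Finset.smul_sum]
  refine Finset.sum_congr rfl fun x _ => ?_
  rw [map_smul, hΦ, hδ, map_smul, smul_comm, ← hδ]

/-- Two isomorphisms of Heisenberg representations that agree at one entry are equal. -/
theorem Fibre.equiv_ext (hF : (2 : F) ≠ 0) (hψ : ψ ≠ 1) {Φ Φ' : Fibre ψ L ≃ₗ[ℂ] Fibre ψ M}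
    (hΦ : ∀ h f, Φ (fibreRep ψ L h f) = fibreRep ψ M h (Φ f))
    (hΦ' : ∀ h f, Φ' (fibreRep ψ L h f) = fibreRep ψ M h (Φ' f))
    (h0 : (Φ (Fibre.delta ψ L)).1 1 ≠ 0)
    (h : (Φ' (Fibre.delta ψ L)).1 1 = (Φ (Fibre.delta ψ L)).1 1) : Φ' = Φ := by
  obtain ⟨c, hc⟩ := Fibre.end_eq_smul hF hψ ((Φ'.trans Φ.symm : Fibre ψ L ≃ₗ[ℂ] Fibre ψ L) :
    Fibre ψ L →ₗ[ℂ] Fibre ψ L) fun g f => by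
      apply Φ.injective
      simp [hΦ, hΦ']
  have hc' : ∀ f, Φ' f = c • Φ f := fun f => by
    have := congrArg Φ (hc f)
    simpa using this
  have h1 : c = 1 := by
    rw [hc'] at h
    exact (mul_eq_right₀ h0).1 h
  ext1 f
  rw [hc', h1, one_smul]

end

/-! ### The canonical intertwining operators -/

section

variable {F : Type v} [Field F] {V : Symp.{u, v} F} {ψ : AddChar F ℂ}

section

variable [Fintype F] {L M N S : OLag V}

theorem averaging_apply (f : Fibre ψ L) (h : Heis V) :
    (averaging ψ M L f).1 h = ∑ m : M.lag, f.1 (Heis.ofVec m.1 * h) := rfl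

theorem averaging_fibreRep (h : Heis V) (f : Fibre ψ L) :
    averaging ψ M L (fibreRep ψ L h f) = fibreRep ψ M h (averaging ψ M L f) := by
  ext g
  simp only [averaging_apply, Fibre.fibreRep_apply, mul_assoc]

/-- Commuting `m` past `l` produces `ψ(ω(m, l))`; the sum over `L` leaves only `m ∈ L ∩ M = 0`, with
weight `|L| = q^n`. -/
theorem averaging_averaging (hF : (2 : F) ≠ 0) (hψ : ψ ≠ 1) (hLM : L.lag ⊔ M.lag = ⊤)
    (f : Fibre ψ L) :
    averaging ψ L M (averaging ψ M L f) = (Fintype.card F : ℂ) ^ halfDim V • f := by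
  classical
  have hinf := (L.isLagrangian.sup_eq_top_iff M.isLagrangian).1 hLM
  ext h
  change _ = _ * f.1 h
  rw [averaging_apply]
  simp only [averaging_apply]
  rw [Finset.sum_comm]
  have h1 : ∀ m : M.lag, ∑ l : L.lag, f.1 (Heis.ofVec m.1 * (Heis.ofVec l.1 * h)) =
      if m = 0 then (Fintype.card F : ℂ) ^ halfDim V * f.1 h else 0 := by
    intro m
    have h2 : ∀ l : L.lag, f.1 (Heis.ofVec m.1 * (Heis.ofVec l.1 * h)) =
        ψ (V.form m.1 l.1) * f.1 (Heis.ofVec m.1 * h) := by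
      intro l
      rw [← mul_assoc, Heis.mul_ofVec_comm hF, mul_assoc, mul_assoc, f.2.1, f.2.2 _ l.2]
      rfl
    rw [Finset.sum_congr rfl fun l _ => h2 l, ← Finset.sum_mul, sum_addChar_form hψ]
    have hm : m.1 ∈ L.lag ↔ m = 0 := by
      constructor
      · intro hm
        have : m.1 ∈ L.lag ⊓ M.lag := ⟨hm, m.2⟩
        rw [hinf, Submodule.mem_bot] at this
        exact Subtype.ext this
      · rintro rfl
        exact L.lag.zero_mem
    simp only [hm]
    split_ifs with h0
    · subst h0
      rw [card_lag]
      congr 1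
      refine congrArg f.1 ?_
      exact one_mul h
    · rw [zero_mul]
  rw [Finset.sum_congr rfl fun m _ => h1 m, Finset.sum_ite_eq' Finset.univ 0]
  simp

/-- The matrix entry of a composition of two averaging operators. -/
theorem averaging_averaging_delta (hSL : IsCompl S.lag L.lag) :
    (averaging ψ N S (averaging ψ S L (Fibre.delta ψ L))).1 1 =
      ∑ x : N.lag, ψ ((2 : F)⁻¹ * V.form x (S.lag.projectionOnto L.lag hSL x : V)) := by
  rw [averaging_apply]
  refine Finset.sum_congr rfl fun x _ => ?_
  rw [averaging_apply, mul_one]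
  have hx : ∀ y : V, y - (S.lag.projectionOnto L.lag hSL y : V) ∈ L.lag := fun y => by
    rw [← Submodule.projectionOnto_apply_eq_zero_iff hSL, map_sub,
      Submodule.projectionOnto_apply_left, sub_self]
  -- The delta function sees only `s` with `s + x ∈ L`, that is, `s = -p x`; the group law
  -- contributes the phase `½ ω(-p x, x) = ½ ω(x, p x)`.
  rw [Finset.sum_eq_single (-(S.lag.projectionOnto L.lag hSL x))]
  · rw [Fibre.delta_apply_of_mem]
    · simp [Heis.ofVec, form_swap x.1]
    · have := hx x.1
      simpa [Heis.ofVec, sub_eq_neg_add] using this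
  · intro s _ hs
    rw [Fibre.delta_apply_of_notMem]
    intro hmem
    apply hs
    have h1 : s.1 + x.1 ∈ L.lag := hmem
    rw [← Submodule.projectionOnto_apply_eq_zero_iff hSL, map_add,
      Submodule.projectionOnto_apply_left] at h1
    exact eq_neg_of_add_eq_zero_left h1
  · intro h
    exact absurd (Finset.mem_univ _) h

theorem averaging_delta (hLM : L.lag ⊓ M.lag = ⊥) :
    (averaging ψ M L (Fibre.delta ψ L)).1 1 = 1 := by
  rw [averaging_apply, Finset.sum_eq_single 0]
  · rw [mul_one]
    exact Fibre.delta_one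
  · intro m _ hm
    rw [mul_one, Fibre.delta_apply_of_notMem]
    intro h
    have : m.1 ∈ L.lag ⊓ M.lag := ⟨h, m.2⟩
    rw [hLM, Submodule.mem_bot] at this
    exact hm (Subtype.ext this)
  · intro h
    exact absurd (Finset.mem_univ _) h

end

/-- The number `(-1)^(n choose 2) ω_∧(o_L, o_M)`. -/
def orientForm (L M : OLag V) : F :=
  (-1) ^ (halfDim V).choose 2 * wedgeForm V L.orient M.orient

theorem orientForm_swap (L M : OLag V) :
    orientForm M L = (-1) ^ halfDim V * orientForm L M := by
  let l := Module.finBasisOfFinrankEq F L.lag L.isLagrangian.finrank_eq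
  let m := Module.finBasisOfFinrankEq F M.lag M.isLagrangian.finrank_eq
  obtain ⟨a, -, ha⟩ := L.exists_coeff (Equiv.refl _) l
  obtain ⟨b, -, hb⟩ := M.exists_coeff (Equiv.refl _) m
  rw [orientForm, orientForm, wedgeForm_orient _ l m ha hb,
    wedgeForm_orient _ m l hb ha, gram_swap, Matrix.det_neg, Matrix.det_transpose,
    Fintype.card_fin]
  ring

theorem orientForm_ne_zero {L M : OLag V} (h : L.lag ⊔ M.lag = ⊤) : orientForm L M ≠ 0 := by
  let l := Module.finBasisOfFinrankEq F L.lag L.isLagrangian.finrank_eq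
  let m := Module.finBasisOfFinrankEq F M.lag M.isLagrangian.finrank_eq
  obtain ⟨a, ha0, ha⟩ := L.exists_coeff (Equiv.refl _) l
  obtain ⟨b, hb0, hb⟩ := M.exists_coeff (Equiv.refl _) m
  rw [orientForm, wedgeForm_orient _ l m ha hb]
  exact mul_ne_zero (mul_ne_zero ha0 hb0) (det_gram_ne_zero L.isLagrangian
    ((L.isLagrangian.sup_eq_top_iff M.isLagrangian).1 h) l m)

/-! ### Normalization constants and independence of the intermediate Lagrangian -/

variable [Fintype F] [DecidableEq F] {L M N S : OLag V}

theorem normConst_eq (ψ : AddChar F ℂ) (M L : OLag V) :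
    normConst ψ M L =
      (gauss ψ / Fintype.card F) ^ halfDim V * quadraticCharC F (orientForm L M) := rfl

theorem gauss_div_pow_mul_self (hF : ringChar F ≠ 2) (hψ : ψ ≠ 1) (n : ℕ) :
    (gauss ψ / Fintype.card F) ^ n * (gauss ψ / Fintype.card F) ^ n =
      quadraticCharC F (-1) ^ n / (Fintype.card F : ℂ) ^ n := by
  have hq := card_ne_zero_complex (F := F)
  rw [← mul_pow, ← div_pow, div_mul_div_comm, ← pow_two, gauss_sq hF hψ]
  field_simp

theorem quadraticCharC_neg_one_pow_mul_self (n : ℕ) :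
    quadraticCharC F (-1) ^ n * quadraticCharC F ((-1) ^ n) = 1 := by
  rw [map_pow, ← mul_pow, quadraticCharC_mul_self (neg_ne_zero.2 one_ne_zero), one_pow]

/-- `G₁² = σ(-1) q` gives `(G₁/q)^{2n} = σ(-1)^n / q^n`, and the sign cancels the `σ((-1)^n)` from
exchanging `L` and `M`. -/
theorem normConst_mul_normConst (hF : ringChar F ≠ 2) (hψ : ψ ≠ 1) (h : L.lag ⊔ M.lag = ⊤) :
    normConst ψ L M * normConst ψ M L * (Fintype.card F : ℂ) ^ halfDim V = 1 := by
  have hq := card_ne_zero_complex (F := F)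
  have h1 := quadraticCharC_mul_self (orientForm_ne_zero h)
  have h2 := quadraticCharC_neg_one_pow_mul_self (F := F) (halfDim V)
  have h3 := gauss_div_pow_mul_self hF hψ (halfDim V)
  rw [eq_div_iff (pow_ne_zero _ hq)] at h3
  rw [normConst_eq, normConst_eq, orientForm_swap, map_mul]
  linear_combination (quadraticCharC F ((-1) ^ halfDim V) * quadraticCharC F (orientForm L M) *
    quadraticCharC F (orientForm L M)) * h3 +
    (quadraticCharC F (orientForm L M) * quadraticCharC F (orientForm L M)) * h2 + h1

theorem ansatz_comp (hF : ringChar F ≠ 2) (hψ : ψ ≠ 1) (h : L.lag ⊔ M.lag = ⊤) (f : Fibre ψ L) :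
    normConst ψ L M • averaging ψ L M (normConst ψ M L • averaging ψ M L f) = f := by
  rw [map_smul, averaging_averaging (Ring.two_ne_zero hF) hψ h, smul_smul, smul_smul,
    normConst_mul_normConst hF hψ h, one_smul]

/-- The operator `A_{M,L} F_{M,L}` for Lagrangians in general position. -/
def ansatz (hF : ringChar F ≠ 2) (hψ : ψ ≠ 1) (h : L.lag ⊔ M.lag = ⊤) :
    Fibre ψ L ≃ₗ[ℂ] Fibre ψ M :=
  LinearEquiv.ofLinearMap (normConst ψ M L • averaging ψ M L) (normConst ψ L M • averaging ψ L M)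
    (LinearMap.ext fun f => ansatz_comp hF hψ (by rwa [sup_comm]) f)
    (LinearMap.ext fun f => ansatz_comp hF hψ h f)

theorem ansatz_apply (hF : ringChar F ≠ 2) (hψ : ψ ≠ 1) (h : L.lag ⊔ M.lag = ⊤)
    (f : Fibre ψ L) : ansatz hF hψ h f = normConst ψ M L • averaging ψ M L f := rfl

theorem ansatz_fibreRep (hF : ringChar F ≠ 2) (hψ : ψ ≠ 1) (h : L.lag ⊔ M.lag = ⊤) (g : Heis V)
    (f : Fibre ψ L) : ansatz hF hψ h (fibreRep ψ L g f) = fibreRep ψ M g (ansatz hF hψ h f) := by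
  rw [ansatz_apply, ansatz_apply, averaging_fibreRep, map_smul]

theorem ansatz_ansatz (hF : ringChar F ≠ 2) (hψ : ψ ≠ 1) (h : L.lag ⊔ M.lag = ⊤)
    (h' : M.lag ⊔ L.lag = ⊤) (f : Fibre ψ L) : ansatz hF hψ h' (ansatz hF hψ h f) = f :=
  ansatz_comp hF hψ h f

/-- The matrix entry of `T_{N,S} T_{S,L}` at the delta functions does not depend on `S`. -/
theorem exists_entry (hF : ringChar F ≠ 2) (hψ : ψ ≠ 1) (N L : OLag V) :
    ∃ c : ℂ, (∀ (S : OLag V) (h₁ : L.lag ⊔ S.lag = ⊤) (h₂ : S.lag ⊔ N.lag = ⊤),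
      (ansatz hF hψ h₂ (ansatz hF hψ h₁ (Fibre.delta ψ L))).1 1 = c ∧ c ≠ 0) ∧
      (L.lag ⊔ N.lag = ⊤ → c = normConst ψ N L) := by
  obtain ⟨k, m, l, e, hel, he, hk⟩ := exists_adapted_bases L.isLagrangian N.isLagrangian
  have hn : k + m = halfDim V := by
    rw [← L.isLagrangian.finrank_eq, Module.finrank_eq_card_basis l]
    simp
  let ε : Fin (halfDim V) ≃ Fin k ⊕ Fin m := (finCongr hn.symm).trans finSumFinEquiv.symm
  obtain ⟨a, ha0, ha⟩ := L.exists_coeff ε l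
  obtain ⟨b, hb0, hb⟩ := N.exists_coeff ε e
  set q : ℂ := (Fintype.card F : ℂ) with hqdef
  have hq : q ≠ 0 := card_ne_zero_complex
  set R := (gram (fun i => (l (Sum.inr i) : V)) (fun j => (e (Sum.inr j) : V))).det with hR
  have hG := gauss_ne_zero hF hψ
  -- The first two powers come from the two normalization constants, `σ((-1)^n)` from exchanging `N`
  -- and `S` in the pairing, and `q^k G₁^m` from the Gauss sum; `σ(abR)` is what survives of the
  -- determinants.
  refine ⟨(gauss ψ / q) ^ halfDim V * (gauss ψ / q) ^ halfDim V *
    (quadraticCharC F ((-1) ^ halfDim V) * quadraticCharC F (a * b * R)) *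
    (q ^ k * gauss ψ ^ m), ?_, ?_⟩
  · intro S h₁ h₂
    have hSL : IsCompl S.lag L.lag :=
      (L.isLagrangian.isCompl S.isLagrangian h₁).symm
    have hNS : N.lag ⊓ S.lag = ⊥ := by
      rw [inf_comm]; exact (S.isLagrangian.sup_eq_top_iff N.isLagrangian).1 h₂
    let s := (Module.finBasisOfFinrankEq F S.lag S.isLagrangian.finrank_eq).reindex ε
    obtain ⟨d, hd0, hd⟩ := S.exists_coeff ε s
    obtain ⟨c, hc0, hc⟩ := det_gram_mul_det_gram L.isLagrangian N.isLagrangian hSL hNS hel he s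
    have hX := det_gram_ne_zero L.isLagrangian
      ((L.isLagrangian.sup_eq_top_iff S.isLagrangian).1 h₁) l s
    have hW := det_gram_ne_zero N.isLagrangian hNS e s
    have hD := projGram_det_ne_zero L.isLagrangian N.isLagrangian hSL hNS hel he
    have e1 : orientForm L S = a * d * _ := wedgeForm_orient ε l s ha hd
    have e2 : orientForm N S = b * d * _ := wedgeForm_orient ε e s hb hd
    have hsum := sum_addChar_projectionOnto hF hψ L.isLagrangian S.isLagrangian N.isLagrangian
      hSL hNS hel he
    rw [ansatz_apply, ansatz_apply, map_smul, smul_smul]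
    change normConst ψ N S * normConst ψ S L *
      (averaging ψ N S (averaging ψ S L (Fibre.delta ψ L))).1 1 = _ ∧ _
    rw [averaging_averaging_delta hSL, hsum, normConst_eq, normConst_eq, orientForm_swap N S,
      e1, e2]
    rw [← hR] at hc
    set X := (gram (fun i => (l i : V)) (fun i => (s i : V))).det with hXdef
    set W := (gram (fun i => (e i : V)) (fun i => (s i : V))).det with hWdef
    set D := (projGram hSL fun j => (e (Sum.inr j) : V)).det with hDdef
    have hR0 : R ≠ 0 := by
      intro h0
      rw [h0, mul_zero] at hc
      exact mul_ne_zero (mul_ne_zero hX hW) (pow_ne_zero 2 hc0) hc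
    have hchar : quadraticCharC F X * quadraticCharC F W * quadraticCharC F D =
        quadraticCharC F R := by
      have := congrArg (quadraticCharC F) hc
      rw [map_mul, map_mul, map_mul, map_pow, quadraticCharC_sq hc0, mul_one] at this
      rw [this, mul_right_comm, quadraticCharC_mul_self hD, one_mul]
    constructor
    · simp only [map_mul]
      rw [← hchar]
      -- The coefficient `d` of `o_S` occurs in both constants, so it enters as `σ(d)² = 1`.
      linear_combination ((gauss ψ / q) ^ halfDim V * (gauss ψ / q) ^ halfDim V *
        quadraticCharC F ((-1) ^ halfDim V) * quadraticCharC F a * quadraticCharC F b *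
        quadraticCharC F X * quadraticCharC F W * quadraticCharC F D * q ^ k * gauss ψ ^ m) *
        quadraticCharC_mul_self hd0
    · have hne : ∀ x : F, x ≠ 0 → quadraticCharC F x ≠ 0 := fun x hx h0 => by
        have := quadraticCharC_sq hx
        rw [h0] at this
        simp at this
      have h1 := hne _ (pow_ne_zero (halfDim V) (neg_ne_zero.2 (one_ne_zero (α := F))))
      have h2 := hne _ (mul_ne_zero (mul_ne_zero ha0 hb0) hR0)
      have h3 := pow_ne_zero (halfDim V) (div_ne_zero hG hq)
      exact mul_ne_zero (mul_ne_zero (mul_ne_zero h3 h3) (mul_ne_zero h1 h2))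
        (mul_ne_zero (pow_ne_zero _ hq) (pow_ne_zero _ hG))
  · intro hLN
    -- With `k = 0` the block `R` is the whole Gram determinant of `L` and `N`, and the power of `q`
    -- is `1`.
    obtain rfl := hk hLN
    have hdet : (gram (fun i => (l i : V)) (fun i => (e i : V))).det = R := by
      have h1 : gram (fun i => (l i : V)) (fun i => (e i : V)) = Matrix.fromBlocks
          (Matrix.of fun i _ => i.elim0) (Matrix.of fun i _ => i.elim0) 0
          (gram (fun i => (l (Sum.inr i) : V)) (fun j => (e (Sum.inr j) : V))) := by
        ext (i | i) (j | j)
        · exact i.elim0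
        · exact i.elim0
        · exact j.elim0
        · rfl
      rw [h1, Matrix.det_fromBlocks_zero₂₁, Matrix.det_isEmpty, one_mul]
    have e1 : orientForm L N = a * b * _ := wedgeForm_orient ε l e ha hb
    have hm : m = halfDim V := by omega
    have h2 := quadraticCharC_neg_one_pow_mul_self (F := F) (halfDim V)
    have h3 := gauss_div_pow_mul_self hF hψ (halfDim V)
    rw [normConst_eq, e1, hdet, h3, pow_zero, one_mul, div_pow, hm]
    linear_combination (quadraticCharC F (a * b * R) * gauss ψ ^ halfDim V /
      (Fintype.card F : ℂ) ^ halfDim V) * h2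

end

/-! ### The canonical trivialization -/

section

variable {F : Type v} [Field F] [Fintype F] [DecidableEq F] {V : Symp.{u, v} F}
  {ψ : AddChar F ℂ} {L M N S : OLag V}

/-- The composition `T_{M,S} T_{S,L}` for `S` transversal to `L` and `M`. -/
def ansatzThrough (hF : ringChar F ≠ 2) (hψ : ψ ≠ 1) (h₁ : L.lag ⊔ S.lag = ⊤)
    (h₂ : S.lag ⊔ M.lag = ⊤) : Fibre ψ L ≃ₗ[ℂ] Fibre ψ M :=
  (ansatz hF hψ h₁).trans (ansatz hF hψ h₂)

theorem ansatzThrough_fibreRep (hF : ringChar F ≠ 2) (hψ : ψ ≠ 1) (h₁ : L.lag ⊔ S.lag = ⊤)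
    (h₂ : S.lag ⊔ M.lag = ⊤) (g : Heis V) (f : Fibre ψ L) :
    ansatzThrough hF hψ h₁ h₂ (fibreRep ψ L g f) =
      fibreRep ψ M g (ansatzThrough hF hψ h₁ h₂ f) := by
  simp only [ansatzThrough, LinearEquiv.trans_apply, ansatz_fibreRep]

/-- Schur's lemma reduces the equality to the entry computed in `exists_entry`. -/
theorem ansatzThrough_eq (hF : ringChar F ≠ 2) (hψ : ψ ≠ 1) {S' : OLag V}
    (h₁ : L.lag ⊔ S.lag = ⊤) (h₂ : S.lag ⊔ M.lag = ⊤) (h₁' : L.lag ⊔ S'.lag = ⊤)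
    (h₂' : S'.lag ⊔ M.lag = ⊤) :
    ansatzThrough hF hψ h₁ h₂ = ansatzThrough hF hψ h₁' h₂' := by
  obtain ⟨c, hc, -⟩ := exists_entry hF hψ M L
  refine Fibre.equiv_ext (Ring.two_ne_zero hF) hψ (ansatzThrough_fibreRep hF hψ h₁' h₂')
    (ansatzThrough_fibreRep hF hψ h₁ h₂) ?_ ?_
  · exact (hc S' h₁' h₂').1.trans_ne (hc S' h₁' h₂').2
  · exact (hc S h₁ h₂).1.trans (hc S' h₁' h₂').1.symm

theorem ansatzThrough_eq_ansatz (hF : ringChar F ≠ 2) (hψ : ψ ≠ 1)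
    (h₁ : L.lag ⊔ S.lag = ⊤) (h₂ : S.lag ⊔ M.lag = ⊤) (h : L.lag ⊔ M.lag = ⊤) :
    ansatzThrough hF hψ h₁ h₂ = ansatz hF hψ h := by
  obtain ⟨c, hc, hc'⟩ := exists_entry hF hψ M L
  have h0 : (ansatz hF hψ h (Fibre.delta ψ L)).1 1 = c := by
    rw [ansatz_apply, hc' h]
    change _ * (averaging ψ M L (Fibre.delta ψ L)).1 1 = _
    rw [averaging_delta ((L.isLagrangian.sup_eq_top_iff M.isLagrangian).1 h), mul_one]
  refine Fibre.equiv_ext (Ring.two_ne_zero hF) hψ (ansatz_fibreRep hF hψ h)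
    (ansatzThrough_fibreRep hF hψ h₁ h₂) ?_ ?_
  · exact h0.trans_ne (hc S h₁ h₂).2
  · exact (hc S h₁ h₂).1.trans h0.symm

/-- The canonical operator `T_{M,L}`. -/
def canonicalOp (hF : ringChar F ≠ 2) (hψ : ψ ≠ 1) (M L : OLag V) : Fibre ψ L ≃ₗ[ℂ] Fibre ψ M :=
  ansatzThrough hF hψ (OLag.exists_middle (Ring.two_ne_zero hF) L M).choose_spec.1
    (OLag.exists_middle (Ring.two_ne_zero hF) L M).choose_spec.2

theorem canonicalOp_eq (hF : ringChar F ≠ 2) (hψ : ψ ≠ 1) (h₁ : L.lag ⊔ S.lag = ⊤)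
    (h₂ : S.lag ⊔ M.lag = ⊤) : canonicalOp hF hψ M L = ansatzThrough hF hψ h₁ h₂ :=
  ansatzThrough_eq hF hψ _ _ _ _

/-- The canonical trivialization. -/
def canonical (hF : ringChar F ≠ 2) (hψ : ψ ≠ 1) (V : Symp.{u, v} F) : Trivialization ψ V where
  T := canonicalOp hF hψ
  intertwines M L h f := ansatzThrough_fibreRep hF hψ _ _ h f
  multiplicative N M L f := by
    -- Routing all three operators through a common `S` makes the inner factors `T_{S,M} T_{M,S}`
    -- cancel.
    obtain ⟨S, hN, hM, hL⟩ := OLag.exists_transversal (Ring.two_ne_zero hF) N M L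
    have hL' := hL
    have hM' := hM
    rw [sup_comm] at hL' hM'
    rw [canonicalOp_eq hF hψ hL' hM, canonicalOp_eq hF hψ hM' hN, canonicalOp_eq hF hψ hL' hN]
    simp only [ansatzThrough, LinearEquiv.trans_apply, ansatz_ansatz]

theorem canonical_extendsAnsatz (hF : ringChar F ≠ 2) (hψ : ψ ≠ 1) (V : Symp.{u, v} F) :
    (canonical hF hψ V).ExtendsAnsatz := by
  intro M L h
  obtain ⟨S, h₁, h₂⟩ := OLag.exists_middle (Ring.two_ne_zero hF) L M
  have : (canonical hF hψ V).T M L = ansatz hF hψ h :=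
    (canonicalOp_eq hF hψ h₁ h₂).trans (ansatzThrough_eq_ansatz hF hψ h₁ h₂ h)
  rw [this]
  rfl

/-- Multiplicativity factors every operator through an `S` transversal to both ends, where the
formula applies. -/
theorem Trivialization.ExtendsAnsatz.unique (hF : ringChar F ≠ 2)
    {T T' : Trivialization ψ V} (hT : T.ExtendsAnsatz) (hT' : T'.ExtendsAnsatz) : T = T' := by
  have key : ∀ M L : OLag V, L.lag ⊔ M.lag = ⊤ → T.T M L = T'.T M L := fun M L h =>
    LinearEquiv.toLinearMap_injective ((hT M L h).trans (hT' M L h).symm)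
  ext M L f : 4
  obtain ⟨S, h₁, h₂⟩ := OLag.exists_middle (Ring.two_ne_zero hF) L M
  rw [← T.multiplicative M S L, ← T'.multiplicative M S L, key _ _ h₁, key _ _ h₂]

end

/-! ### Naturality -/

section

variable {F : Type v} [Field F] {U V W : Symp.{u, v} F}

theorem Heis.map_mul (f : V ⟶ W) (a b : Heis V) : (a * b).map f = a.map f * b.map f := by
  ext
  · simp [Heis.map]
  · simp [Heis.map, form_toLin]

theorem Heis.map_comp (f : U ⟶ V) (g : V ⟶ W) (a : Heis U) : a.map (f ≫ g) = (a.map f).map g :=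
  rfl

theorem Heis.map_id (a : Heis V) : a.map (𝟙 V) = a := rfl

theorem Heis.map_ofCenter (f : V ⟶ W) (z : F) :
    (Heis.ofCenter z : Heis V).map f = Heis.ofCenter z := by
  ext <;> simp [Heis.map, Heis.ofCenter]

theorem Heis.map_ofVec (f : V ⟶ W) (x : V) : (Heis.ofVec x).map f = Heis.ofVec (toLin f x) := rfl

/-- `Heis.map f` as a bijection. -/
def Heis.mapEquiv (f : V ⟶ W) : Heis V ≃ Heis W where
  toFun := Heis.map f
  invFun h := ⟨(toLin f).symm h.vec, h.cen⟩
  left_inv h := by ext <;> simp [Heis.map]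
  right_inv h := by ext <;> simp [Heis.map]

/-- The degrees `halfDim V` and `halfDim W` are equal only propositionally; comparing orientations
inside the exterior algebra avoids transport between degrees. -/
theorem coe_exteriorPower_map {A B : Type*} [AddCommGroup A] [Module F A] [AddCommGroup B]
    [Module F B] (n : ℕ) (f : A →ₗ[F] B) (o : ⋀[F]^n A) :
    (exteriorPower.map n f o : ExteriorAlgebra F B) =
      ExteriorAlgebra.map f (o : ExteriorAlgebra F A) := by
  have h : (Submodule.subtype _).comp (exteriorPower.map n f) =
      (ExteriorAlgebra.map f).toLinearMap.comp (Submodule.subtype (⋀[F]^n A)) := by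
    ext x
    simp [ExteriorAlgebra.map_apply_ιMulti]
  exact LinearMap.congr_fun h o

theorem coe_mapTop (f : V ⟶ W) (o : ⋀[F]^(halfDim V) V) :
    (mapTop f o : ExteriorAlgebra F W) =
      ExteriorAlgebra.map (toLin f).toLinearMap (o : ExteriorAlgebra F V) :=
  coe_exteriorPower_map (halfDim V) (toLin f).toLinearMap o

theorem OLag.map_id (L : OLag V) : L.map (𝟙 V) = L := by
  refine OLag.ext (Submodule.map_id _) (Subtype.ext ?_)
  refine (coe_mapTop _ _).trans ?_
  have : ExteriorAlgebra.map (toLin (𝟙 V)).toLinearMap = AlgHom.id F _ := ExteriorAlgebra.map_id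
  rw [this]
  rfl

theorem OLag.map_comp (f : U ⟶ V) (g : V ⟶ W) (L : OLag U) :
    L.map (f ≫ g) = (L.map f).map g := by
  refine OLag.ext (Submodule.map_comp _ _ _) (Subtype.ext ?_)
  refine (coe_mapTop _ _).trans (Eq.trans ?_ (coe_mapTop _ _).symm)
  change _ = ExteriorAlgebra.map (toLin g).toLinearMap (mapTop f L.orient : ExteriorAlgebra F V)
  rw [coe_mapTop, ← AlgHom.comp_apply, ExteriorAlgebra.map_comp_map]
  rfl

theorem OLag.map_orient_eq (f : V ⟶ W) (L : OLag V) {c : F} {x : Fin (halfDim V) → V}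
    (h : L.orient = c • exteriorPower.ιMulti F (halfDim V) x) {y : Fin (halfDim W) → W}
    (hy : ∀ i, y i = toLin f (x (finCongr (finrank_eq_of_hom f).symm i))) :
    (L.map f).orient = c • exteriorPower.ιMulti F (halfDim W) y := by
  obtain rfl := funext hy
  refine Subtype.ext ((coe_mapTop _ _).trans ?_)
  rw [h]
  simp only [Submodule.coe_smul, exteriorPower.ιMulti_apply_coe, map_smul,
    ExteriorAlgebra.map_apply_ιMulti]
  congr 1
  have : ∀ (k : ℕ) (hk : halfDim V = k), ExteriorAlgebra.ιMulti F (halfDim V)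
      (fun i => toLin f (x i)) = ExteriorAlgebra.ιMulti F k
        (fun i => toLin f (x (finCongr hk.symm i))) := by
    rintro k rfl
    rfl
  exact this _ (finrank_eq_of_hom f)

/-- Bases transported by `f` keep their Gram matrix, and the orientations keep their coefficients.
-/
theorem orientForm_map (f : V ⟶ W) (L M : OLag V) :
    orientForm (L.map f) (M.map f) = orientForm L M := by
  let l := Module.finBasisOfFinrankEq F L.lag L.isLagrangian.finrank_eq
  let m := Module.finBasisOfFinrankEq F M.lag M.isLagrangian.finrank_eq
  obtain ⟨a, -, ha⟩ := L.exists_coeff (Equiv.refl _) l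
  obtain ⟨b, -, hb⟩ := M.exists_coeff (Equiv.refl _) m
  let l' : Module.Basis _ F (L.map f).lag := l.map ((toLin f).submoduleMap L.lag)
  let m' : Module.Basis _ F (M.map f).lag := m.map ((toLin f).submoduleMap M.lag)
  let e : Fin (halfDim W) ≃ Fin (halfDim V) := finCongr (finrank_eq_of_hom f).symm
  have hl : ∀ j, (l' j : W) = toLin f (l j) := fun j => rfl
  have hm : ∀ j, (m' j : W) = toLin f (m j) := fun j => rfl
  have ha' : (L.map f).orient =
      a • exteriorPower.ιMulti F (halfDim W) (fun i => (l' (e i) : W)) :=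
    L.map_orient_eq f ha fun i => hl _
  have hb' : (M.map f).orient =
      b • exteriorPower.ιMulti F (halfDim W) (fun i => (m' (e i) : W)) :=
    M.map_orient_eq f hb fun i => hm _
  rw [orientForm, orientForm, wedgeForm_orient e l' m' ha' hb', wedgeForm_orient _ l m ha hb]
  congr 2
  ext i j
  simp only [gram, Matrix.of_apply, hl, hm, form_toLin]

theorem OLag.map_sup_eq_top (f : V ⟶ W) {L M : OLag V} (h : L.lag ⊔ M.lag = ⊤) :
    (L.map f).lag ⊔ (M.map f).lag = ⊤ := by
  change L.lag.map (toLin f).toLinearMap ⊔ M.lag.map (toLin f).toLinearMap = ⊤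
  rw [← Submodule.map_sup, h, Submodule.map_top, LinearEquiv.range]

/-! ### Pull-back of functions and trivializations -/

variable {ψ : AddChar F ℂ}

/-- Pull-back of functions along a symplectic isomorphism. -/
def Fibre.pull (ψ : AddChar F ℂ) (f : V ⟶ W) (L : OLag V) :
    Fibre ψ (L.map f) ≃ₗ[ℂ] Fibre ψ L where
  toFun s := ⟨fun h => s.1 (h.map f), fun z h => by
      change s.1 ((Heis.ofCenter z * h).map f) = ψ z * s.1 (h.map f)
      rw [Heis.map_mul, Heis.map_ofCenter, s.2.1], fun l hl h => by
      change s.1 ((Heis.ofVec l * h).map f) = s.1 (h.map f)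
      rw [Heis.map_mul, Heis.map_ofVec, s.2.2 (toLin f l) ⟨l, hl, rfl⟩]⟩
  map_add' _ _ := rfl
  map_smul' _ _ := rfl
  invFun s := ⟨fun h => s.1 ((Heis.mapEquiv f).symm h), fun z h => by
      obtain ⟨h, rfl⟩ := (Heis.mapEquiv f).surjective h
      rw [← Heis.map_ofCenter f]
      change s.1 ((Heis.mapEquiv f).symm (_ * h.map f)) =
        ψ z * s.1 ((Heis.mapEquiv f).symm (Heis.mapEquiv f h))
      rw [← Heis.map_mul]
      change s.1 ((Heis.mapEquiv f).symm ((Heis.mapEquiv f) _)) = _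
      rw [Equiv.symm_apply_apply, Equiv.symm_apply_apply, s.2.1], by
      rintro _ ⟨l, hl, rfl⟩ h
      obtain ⟨h, rfl⟩ := (Heis.mapEquiv f).surjective h
      change s.1 ((Heis.mapEquiv f).symm ((Heis.ofVec l).map f * h.map f)) =
        s.1 ((Heis.mapEquiv f).symm (Heis.mapEquiv f h))
      rw [← Heis.map_mul]
      change s.1 ((Heis.mapEquiv f).symm ((Heis.mapEquiv f) _)) = _
      rw [Equiv.symm_apply_apply, Equiv.symm_apply_apply, s.2.2 l hl]⟩
  left_inv s := by
    ext h
    exact congrArg s.1 ((Heis.mapEquiv f).apply_symm_apply h)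
  right_inv s := by
    ext h
    exact congrArg s.1 ((Heis.mapEquiv f).symm_apply_apply h)

theorem Fibre.pull_apply (f : V ⟶ W) (L : OLag V) (s : Fibre ψ (L.map f)) (h : Heis V) :
    (Fibre.pull ψ f L s).1 h = s.1 (h.map f) := rfl

theorem Fibre.pull_fibreRep (f : V ⟶ W) (L : OLag V) (h : Heis V) (s : Fibre ψ (L.map f)) :
    Fibre.pull ψ f L (fibreRep ψ _ (h.map f) s) = fibreRep ψ L h (Fibre.pull ψ f L s) := by
  ext g
  rw [Fibre.pull_apply, Fibre.fibreRep_apply, Fibre.fibreRep_apply, Fibre.pull_apply,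
    Heis.map_mul]

theorem Fibre.pull_averaging [Fintype F] (f : V ⟶ W) (M L : OLag V) (s : Fibre ψ (L.map f)) :
    Fibre.pull ψ f M (averaging ψ (M.map f) (L.map f) s) =
      averaging ψ M L (Fibre.pull ψ f L s) := by
  ext h
  rw [Fibre.pull_apply, averaging_apply, averaging_apply]
  let e : M.lag ≃ (M.map f).lag := ((toLin f).submoduleMap M.lag).toEquiv
  refine (Fintype.sum_equiv e _ _ fun m => ?_).symm
  rw [Fibre.pull_apply, Heis.map_mul]
  rfl

theorem Heis.map_hom_inv (g : Sp V) (h : Heis V) :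
    (h.map (Sp.hom g)).map (Sp.hom g⁻¹) = h := by
  ext
  · exact (LinearEquiv.symm_apply_apply g.1 h.vec)
  · rfl

theorem horizontal_ext {T : Trivialization ψ V} {s t : T.horizontal}
    (h : ∀ (L : OLag V) (x : Heis V), (s.1 L).1 x = (t.1 L).1 x) : s = t :=
  Subtype.ext (funext fun L => Subtype.ext (funext fun x => h L x))

/-- Pull-back of a trivialization along a symplectic isomorphism. -/
def Trivialization.pull (f : V ⟶ W) (T : Trivialization ψ W) : Trivialization ψ V where
  T M L := (Fibre.pull ψ f L).symm.trans ((T.T (M.map f) (L.map f)).trans (Fibre.pull ψ f M))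
  intertwines M L h s := by
    obtain ⟨s, rfl⟩ := (Fibre.pull ψ f L).surjective s
    simp only [LinearEquiv.trans_apply, ← Fibre.pull_fibreRep, LinearEquiv.symm_apply_apply,
      T.intertwines]
  multiplicative N M L s := by
    simp only [LinearEquiv.trans_apply, LinearEquiv.symm_apply_apply, T.multiplicative]

/-! ### Naturality of the canonical trivialization, the functor and the Weil representation -/

variable [Fintype F] [DecidableEq F]

theorem normConst_map (f : V ⟶ W) (M L : OLag V) :
    normConst ψ (M.map f) (L.map f) = normConst ψ M L := by
  rw [normConst_eq, normConst_eq, orientForm_map, finrank_eq_of_hom f]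

theorem Trivialization.ExtendsAnsatz.pull {T : Trivialization ψ W} (hT : T.ExtendsAnsatz)
    (f : V ⟶ W) : (T.pull f).ExtendsAnsatz := by
  intro M L h
  ext1 s
  obtain ⟨s, rfl⟩ := (Fibre.pull ψ f L).surjective s
  have h1 := LinearMap.congr_fun (hT _ _ (OLag.map_sup_eq_top f h)) s
  change (Fibre.pull ψ f M) (T.T (M.map f) (L.map f)
    ((Fibre.pull ψ f L).symm (Fibre.pull ψ f L s))) = _
  rw [LinearEquiv.symm_apply_apply]
  refine (congrArg (Fibre.pull ψ f M) h1).trans ?_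
  rw [LinearMap.smul_apply, map_smul, Fibre.pull_averaging, normConst_map]
  rfl

/-- Uniqueness yields naturality: averaging and normalization constants are preserved by `f`, so the
pull-back satisfies the characterizing formula. This is why pull-back preserves horizontality. -/
theorem canonical_pull (hF : ringChar F ≠ 2) (hψ : ψ ≠ 1) (f : V ⟶ W) :
    (canonical hF hψ W).pull f = canonical hF hψ V :=
  ((canonical_extendsAnsatz hF hψ W).pull f).unique hF (canonical_extendsAnsatz hF hψ V)

/-- Pull-back of horizontal sections of the canonical trivializations. -/
def pullSections (hF : ringChar F ≠ 2) (hψ : ψ ≠ 1) (f : V ⟶ W) :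
    (canonical hF hψ W).horizontal →ₗ[ℂ] (canonical hF hψ V).horizontal where
  toFun s := ⟨fun L => Fibre.pull ψ f L (s.1 (L.map f)), fun M L => by
    rw [← canonical_pull hF hψ f]
    change (Fibre.pull ψ f M) ((canonical hF hψ W).T (M.map f) (L.map f)
      ((Fibre.pull ψ f L).symm (Fibre.pull ψ f L _))) = _
    rw [LinearEquiv.symm_apply_apply, s.2]⟩
  map_add' _ _ := rfl
  map_smul' _ _ := rfl

theorem pullSections_apply (hF : ringChar F ≠ 2) (hψ : ψ ≠ 1) (f : V ⟶ W)
    (s : (canonical hF hψ W).horizontal) (L : OLag V) (h : Heis V) :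
    ((pullSections hF hψ f s).1 L).1 h = (s.1 (L.map f)).1 (h.map f) := rfl

theorem pullSections_id (hF : ringChar F ≠ 2) (hψ : ψ ≠ 1) (V : Symp.{u, v} F) :
    pullSections hF hψ (𝟙 V) = LinearMap.id := by
  ext1 s
  refine horizontal_ext fun L x => ?_
  rw [pullSections_apply, OLag.map_id, Heis.map_id]
  rfl

theorem pullSections_comp (hF : ringChar F ≠ 2) (hψ : ψ ≠ 1) (f : U ⟶ V) (g : V ⟶ W) :
    pullSections hF hψ (f ≫ g) = pullSections hF hψ f ∘ₗ pullSections hF hψ g := by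
  ext1 s
  refine horizontal_ext fun L x => ?_
  rw [pullSections_apply, OLag.map_comp, Heis.map_comp]
  rfl

/-- The quantization functor. -/
def quantization (hF : ringChar F ≠ 2) (hψ : ψ ≠ 1) :
    (Symp.{u, v} F)ᵒᵖ ⥤ FGModuleCat.{max u v} ℂ where
  obj V := FGModuleCat.of ℂ (canonical hF hψ V.unop).horizontal
  map f := FGModuleCat.ofHom (pullSections hF hψ f.unop)
  map_id V := by
    ext1
    exact pullSections_id hF hψ V.unop
  map_comp f g := by
    ext1
    exact pullSections_comp hF hψ g.unop f.unop

theorem onSections_quantization (hF : ringChar F ≠ 2) (hψ : ψ ≠ 1) (f : V ⟶ W) :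
    onSections (T := canonical hF hψ) (Q := quantization.{u, v} hF hψ) (fun _ => rfl) f =
      pullSections hF hψ f := by
  rfl

/-- The Weil representation. -/
def weilRep (hF : ringChar F ≠ 2) (hψ : ψ ≠ 1) (V : Symp.{u, v} F) :
    Representation ℂ (Sp V) (canonical hF hψ V).horizontal where
  -- The inverse turns the contravariant pull-back into a left action.
  toFun g := pullSections hF hψ (Sp.hom g⁻¹)
  map_one' := by
    rw [inv_one]
    exact pullSections_id hF hψ V
  map_mul' a b := by
    rw [mul_inv_rev]
    exact pullSections_comp hF hψ (Sp.hom a⁻¹) (Sp.hom b⁻¹)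

theorem weilRep_comp_heisRep (hF : ringChar F ≠ 2) (hψ : ψ ≠ 1) (g : Sp V) (h : Heis V) :
    weilRep hF hψ V g ∘ₗ (canonical hF hψ V).heisRep h =
      (canonical hF hψ V).heisRep (h.map (Sp.hom g)) ∘ₗ weilRep hF hψ V g := by
  ext1 s
  refine horizontal_ext fun L x => ?_
  change (s.1 (L.map (Sp.hom g⁻¹))).1 (x.map (Sp.hom g⁻¹) * h) =
    (s.1 (L.map (Sp.hom g⁻¹))).1 ((x * h.map (Sp.hom g)).map (Sp.hom g⁻¹))
  rw [Heis.map_mul, Heis.map_hom_inv]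

end

/-! ### Irreducibility -/

section

variable {F : Type v} [Field F] {V : Symp.{u, v} F} {ψ : AddChar F ℂ}

namespace Trivialization

variable (T : Trivialization ψ V)

theorem T_self (L : OLag V) (f : Fibre ψ L) : T.T L L f = f :=
  (T.T L L).injective (T.multiplicative L L L f)

/-- Evaluation of horizontal sections at an oriented Lagrangian. -/
def eval (L : OLag V) : T.horizontal ≃ₗ[ℂ] Fibre ψ L where
  toFun s := s.1 L
  map_add' _ _ := rfl
  map_smul' _ _ := rfl
  invFun f := ⟨fun M => T.T M L f, fun _ _ => T.multiplicative _ _ _ f⟩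
  left_inv s := Subtype.ext (funext fun M => s.2 M L)
  right_inv f := T.T_self L f

theorem eval_heisRep (L : OLag V) (h : Heis V) (s : T.horizontal) :
    T.eval L (T.heisRep h s) = fibreRep ψ L h (T.eval L s) := rfl

theorem heisRep_ofCenter (z : F) : T.heisRep (Heis.ofCenter z) = ψ z • LinearMap.id := by
  ext1 s
  refine Subtype.ext (funext fun L => Subtype.ext (funext fun x => ?_))
  change (s.1 L).1 (x * Heis.ofCenter z) = ψ z * (s.1 L).1 x
  rw [← (s.1 L).2.1]
  refine congrArg (s.1 L).1 (Heis.ext ?_ ?_)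
  · simp [Heis.ofCenter]
  · simp [Heis.ofCenter, add_comm]

/-- Evaluation at one `L` reduces to a single fibre. A non-zero vector can be translated to be
non-zero at `1`; its sum over `L` is then a non-zero multiple of the delta function, whose
translates span the fibre. -/
theorem isIrreducible [Fintype F] (hF : (2 : F) ≠ 0) (hψ : ψ ≠ 1) :
    Representation.IsIrreducible (k := ℂ) (G := Heis V) (V := T.horizontal) T.heisRep := by
  have : Finite V := Module.finite_of_finite F
  have : Fintype V := Fintype.ofFinite V
  obtain ⟨L⟩ := (inferInstance : Nonempty (OLag V))
  have hq := card_lag_ne_zero L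
  have hnt : Nontrivial (Subrepresentation T.heisRep) := by
    refine ⟨⊥, ⊤, fun h => ?_⟩
    have h1 : (T.eval L).symm (Fibre.delta ψ L) ∈ (⊥ : Subrepresentation T.heisRep) := by
      rw [h]; trivial
    have h2 : (T.eval L).symm (Fibre.delta ψ L) = 0 := h1
    have h3 := (T.eval L).symm.map_eq_zero_iff.1 h2
    have h4 := Fibre.delta_one (ψ := ψ) (L := L)
    rw [h3] at h4
    exact zero_ne_one h4
  refine { hnt with eq_bot_or_eq_top := fun W => or_iff_not_imp_left.2 fun hW => ?_ }
  obtain ⟨s, hsW, hs⟩ : ∃ s ∈ W.toSubmodule, s ≠ 0 := by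
    by_contra! hcon
    apply hW
    apply Subrepresentation.toSubmodule_injective
    exact (Submodule.eq_bot_iff _).2 hcon
  obtain ⟨g, hg⟩ : ∃ g, (T.eval L s).1 g ≠ 0 := by
    by_contra! hcon
    exact hs ((T.eval L).map_eq_zero_iff.1 (Subtype.ext (funext hcon)))
  set t := T.heisRep g s with ht
  have htW : t ∈ W.toSubmodule := W.apply_mem_toSubmodule g hsW
  have ht1 : (T.eval L t).1 1 ≠ 0 := by
    rw [ht, eval_heisRep, Fibre.fibreRep_apply, one_mul]
    exact hg
  have hδ : (T.eval L).symm (Fibre.delta ψ L) ∈ W.toSubmodule := by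
    have h1 : ∑ l : L.lag, T.heisRep (Heis.ofVec l.1) t ∈ W.toSubmodule :=
      Submodule.sum_mem _ fun l _ => W.apply_mem_toSubmodule _ htW
    have h2 : ∑ l : L.lag, T.heisRep (Heis.ofVec l.1) t =
        ((Fintype.card L.lag : ℂ) * (T.eval L t).1 1) • (T.eval L).symm (Fibre.delta ψ L) := by
      apply (T.eval L).injective
      rw [map_sum, map_smul, LinearEquiv.apply_symm_apply, ← Fibre.sum_fibreRep hF hψ]
      rfl
    rw [h2] at h1
    exact (W.toSubmodule.smul_mem_iff (mul_ne_zero hq ht1)).1 h1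
  apply Subrepresentation.toSubmodule_injective
  refine (Submodule.eq_top_iff').2 fun r => ?_
  rw [← W.toSubmodule.smul_mem_iff hq]
  have h1 : (Fintype.card L.lag : ℂ) • r = ∑ x : V, (T.eval L r).1 (Heis.ofVec x) •
      T.heisRep (Heis.ofVec (-x)) ((T.eval L).symm (Fibre.delta ψ L)) := by
    apply (T.eval L).injective
    rw [map_smul, Fibre.eq_sum_delta, map_sum]
    refine Finset.sum_congr rfl fun x _ => ?_
    rw [map_smul, eval_heisRep, LinearEquiv.apply_symm_apply]
  rw [h1]
  exact Submodule.sum_mem _ fun x _ => Submodule.smul_mem _ _ (W.apply_mem_toSubmodule _ hδ)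

end Trivialization

end

end SympQuant

end

theorem mainTheorem6 {F : Type v} [Field F] [Fintype F] [DecidableEq F] (hF : ringChar F ≠ 2)
    (ψ : AddChar F ℂ) (hψ : ψ ≠ 1) :
    ∃ T : ∀ V : SympQuant.Symp.{u, v} F, SympQuant.Trivialization ψ V,
      -- `T V` is the unique trivialization that extends the explicit formula in general position
      (∀ V, (T V).ExtendsAnsatz ∧
        ∀ T' : SympQuant.Trivialization ψ V, T'.ExtendsAnsatz → T' = T V) ∧
      -- the quantization functor: horizontal sections on objects, pull-back on morphisms
      ∃ (Q : (SympQuant.Symp.{u, v} F)ᵒᵖ ⥤ FGModuleCat.{max u v} ℂ)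
        (hQ : ∀ V, Q.obj (Opposite.op V) = FGModuleCat.of ℂ (T V).horizontal),
        (∀ (V W : SympQuant.Symp.{u, v} F) (f : V ⟶ W) (s : (T W).horizontal)
          (L : SympQuant.OLag V) (h : SympQuant.Heis V),
          ((SympQuant.onSections hQ f s).1 L).1 h = (s.1 (L.map f)).1 (h.map f)) ∧
        -- the canonical model of the Weil representation
        ∀ V : SympQuant.Symp.{u, v} F,
          Representation.IsIrreducible (k := ℂ) (G := SympQuant.Heis V)
            (V := (T V).horizontal) (T V).heisRep ∧
          (∀ z : F, (T V).heisRep (SympQuant.Heis.ofCenter z) = ψ z • LinearMap.id) ∧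
          ∃ ρ : Representation ℂ (SympQuant.Sp V) (T V).horizontal,
            (∀ g, ρ g = SympQuant.onSections hQ (SympQuant.Sp.hom g⁻¹)) ∧
            ∀ (g : SympQuant.Sp V) (h : SympQuant.Heis V),
              ρ g ∘ₗ (T V).heisRep h =
                (T V).heisRep (h.map (SympQuant.Sp.hom g)) ∘ₗ ρ g := by
  refine ⟨SympQuant.canonical hF hψ, fun V => ⟨SympQuant.canonical_extendsAnsatz hF hψ V,
    fun T' hT' => hT'.unique hF (SympQuant.canonical_extendsAnsatz hF hψ V)⟩,
    SympQuant.quantization hF hψ, fun _ => rfl, fun V W f s L h => ?_, fun V =>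
    ⟨(SympQuant.canonical hF hψ V).isIrreducible (Ring.two_ne_zero hF) hψ,
      (SympQuant.canonical hF hψ V).heisRep_ofCenter, SympQuant.weilRep hF hψ V, fun g => ?_,
      SympQuant.weilRep_comp_heisRep hF hψ⟩⟩
  · rw [SympQuant.onSections_quantization]
    rfl
  · rw [SympQuant.onSections_quantization]
    rfl
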